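/- **Setting.** Let $d>2$ and $p\ge 1$ be integers, $\Theta=\{\theta\in\mathbb R^{p-1}:\|\theta\|^2<1\}$, $\beta(\theta)=(\sqrt{1-\|\theta\|^2},\theta^T)^T\in\mathbb R^p$, and let $J(\theta)=\partial\beta(\theta)/\partial\theta$, a $p\times(p-1)$ matrix. Let $(X,Y)\in\mathbb R^p\times\mathbb S^{d-1}$ have joint law $F_0$, put $U_\theta=X^T\beta(\theta)$ with support $\mathcal U_\theta$, write $u_\theta=x^T\beta(\theta)$, and let $f_\theta(y|u)$ be the conditional density of $Y$ given $U_\theta=u$ with respect to the surface measure $\sigma$ on $\mathbb S^{d-1}$. Let $\psi:\mathbb R^d\to\mathbb R$ be a continuous loss function with gradient $\psi'$ and Hessian $\psi''$. For $u\in\mathcal U_\theta$ let $$\mu_\theta(u)=\operatorname{argmin}_{\mu\in\mathbb R^d}\mathbb E[\psi(Y-\mu)\mid U_\theta=u],$$ and let $\theta_0\in\Theta$ minimize $\mathbb E[\psi(Y-\mu_\theta(U_\theta))]$ over $\Theta$. Assume that $(\theta,u)\mapsto\mu_\theta(u)$ is continuously differentiable on $\{(\theta,u):\theta\in\Theta,u\in\mathcal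 U_\theta\}$, with $\mu'_\theta$ its derivative in $u$, and that $u\mapsto\mathbb E[X|U_{\theta_0}=u]$ is taken in a version that is continuous on $\mathcal U_{\theta_0}$. Assume $\mu_{\theta_0}(u)\neq0$ on $\mathcal U_{\theta_0}$, set $\tilde\mu=\mu_{\theta_0}/\|\mu_{\theta_0}\|$, and assume that for some $\kappa>0$, some measurable angular function $f\ge0$ and some constant $c>0$ the conditional density of $Y$ given $X$ is $c\,f(\kappa\,y^T\tilde\mu(U_{\theta_0}))$. **Assumptions.** (A1) $X$ lies almost surely in a compact set $\mathcal X\subset\mathbb R^p$. For every $\theta\in\Theta$, $x^T\beta(\theta)\in\mathcal U_\theta$ for all $x\in\mathcal X$, and $U_\theta$ has a density that is positive in the interior of $\mathcal U_\theta$ and $C^2$ on $\mathcal U_\theta$. (A2) For every compact $K\subset\Theta$ there is $L>0$ with $\|\mu_{\theta_1}(u_{\theta_1})-\mu_{\theta_2}(u_{\theta_2})\|\le L\|\theta_1-\theta_2\|$ for all $x\in\mathcal X$, $\theta_1,\theta_2\in K$; and $P(\mu_\theta(U_\theta)\ne\mu_{\theta_0}(U_{\theta_0}))>0$ for $\theta_0\neq\theta\in\Theta$.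 (A3) For all $\theta\in\Theta$, $u\in\mathcal U_\theta$: near every residual $y-\mu_\theta(u)$, $y\in\mathbb S^{d-1}$, the gradient $\psi'$ exists and is Lipschitz, and $\psi''$ exists at $y-\mu_\theta(u)$ for $\sigma$-almost every $y$ with $f_\theta(y|u)>0$ (both hold if $\psi$ is $C^2$). The matrices $G(u;\theta)=\mathbb E[\psi'(Y-\mu_\theta(u))\psi'(Y-\mu_\theta(u))^T|U_\theta=u]$ and $F(u;\theta)=\mathbb E[\psi''(Y-\mu_\theta(u))|U_\theta=u]$ are positive definite and continuous in $(\theta,u)$. (A4) For $\theta\in\Theta$, $u\in\mathcal U_\theta$, the function $\zeta_\theta(t|u)=\mathbb E[\psi(Y-\mu_\theta(u)+t)|U_\theta=u]$ has its unique minimizer at $t=0$ and is $C^2$ in $t$; for small $t$, and $\tilde u\in\mathcal U_\theta$ in a neighbourhood of $u$, $\zeta_\theta(t|\tilde u)$ and its first two derivatives in $t$ are continuous in $\tilde u$ and bounded. (A5) $f_\theta(y|u)$ is continuous in $u\in\mathcal U_\theta$. For $\theta\in\Theta$, $u\in\mathcal U_\theta$ there are $\epsilon,\delta>0$ and a positive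 function $g$ on $\mathbb S^{d-1}$ with $f_\theta(y|\tilde u)\le g(y)$ for $\tilde u\in\mathcal U_\theta$, $|\tilde u-u|\le\epsilon$, such that $\int\|\psi'(y-\mu_\theta(u))\|^{2+\delta}g\,d\sigma<\infty$ and $\int(\psi(y-t)-\psi(y)+t^T\psi'(y))^2g\,d\sigma=o(\|t\|^2)$ as $t\to0$ (the last integrand being integrable for small $t$). Let $U=U_{\theta_0}$, let $\Sigma_{X|U}$ be the conditional covariance matrix of $X$ given $U$, and suppose that $$W_0=\mathbb E\big[\mu_{\theta_0}'(U)^TF(U;\theta_0)\mu_{\theta_0}'(U)\,J(\theta_0)^T\Sigma_{X|U}J(\theta_0)\big]$$ is invertible. **Influence function.** For $z=(x,y)\in\mathcal X\times\mathbb S^{d-1}$ let $F_\varepsilon=(1-\varepsilon)F_0+\varepsilon\delta_z$. The influence function $\mathrm{IF}(z;\hat\theta,F_0)$ is the limit as $\varepsilon\downarrow0$ of $(T(F_\varepsilon)-T(F_0))/\varepsilon$, where $T(P)$ is a minimizer of $\theta\mapsto\mathbb E_P[\psi(Y-\mu_\theta(U_\theta))]$ over a closed ball around $\theta_0$, with the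 link functions $\mu_\theta$ of $F_0$. It exists if for all sufficiently small radii of the ball minimizers exist for small $\varepsilon\ge0$, $T(F_0)=\theta_0$, and the limit is the same for every choice of the minimizers and every such radius. **Corollary.** The influence function exists at every $z=(x,y)\in\mathcal X\times\mathbb S^{d-1}$ and, with $u=x^T\beta(\theta_0)$, equals $$\mathrm{IF}(z;\hat\theta,F_0)=\psi'(y-\mu_{\theta_0}(u))^T\mu_{\theta_0}'(u)\;W_0^{-1}J(\theta_0)^T\big(x-\mathbb E[X|U_{\theta_0}=u]\big).$$ The gross error sensitivity $\gamma(\hat\theta,F_0)=\sup_{z\in\mathcal X\times\mathbb S^{d-1}}\|\mathrm{IF}(z;\hat\theta,F_0)\|$ is finite, for any loss $\psi$ as above (including least squares): with the spectral norm $\|\cdot\|_2$, $$\gamma(\hat\theta,F_0)\le\|W_0^{-1}J(\theta_0)^T\|_2\,\sup_{z\in\mathcal X\times\mathbb S^{d-1}}\|\psi'(y-\mu_{\theta_0}(u))\|\,\|\mu'_{\theta_0}(u)\|\,\|x-\mathbb E[X|U_{\theta_0}=u]\|<\infty .$$ -/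

import Mathlib

open MeasureTheory Set Filter Topology
open scoped ENNReal Matrix

namespace SphericalSIM

noncomputable section

/-- Euclidean space of dimension `n`. -/
abbrev E (n : ℕ) : Type := EuclideanSpace ℝ (Fin n)

/-- The unit sphere in `ℝ^d`. -/
abbrev Sph (d : ℕ) : Type := Metric.sphere (0 : E d) 1

/-- The unnormalized uniform (surface) measure on the unit sphere. -/
def surf (d : ℕ) : Measure (Sph d) := (volume : Measure (E d)).toSphere

/-- The parameter space: the open unit ball of `ℝ^(p-1)`, where `p = q + 1`. -/
def Param (q : ℕ) : Set (E q) := {θ | ‖θ‖ ^ 2 < 1}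

/-- `β(θ) = (√(1 - ‖θ‖²), θ)`. -/
def beta {q : ℕ} (θ : E q) : E (q + 1) :=
  WithLp.toLp 2 (Fin.cons (Real.sqrt (1 - ‖θ‖ ^ 2)) (fun j => θ j))

/-- The projection index `xᵀ β(θ)`. -/
def index {q : ℕ} (θ : E q) (x : E (q + 1)) : ℝ := inner ℝ x (beta θ)

/-- The `p × (p-1)` Jacobian matrix of `β`. -/
def jac {q : ℕ} (θ : E q) : Matrix (Fin (q + 1)) (Fin q) ℝ :=
  Matrix.of (Fin.cons (fun j => -θ j / Real.sqrt (1 - ‖θ‖ ^ 2))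
    (fun i j => if i = j then 1 else 0))

/-- The spectral norm (largest singular value) of a rectangular real matrix. -/
def specNorm {m n : ℕ} (A : Matrix (Fin m) (Fin n) ℝ) : ℝ :=
  ‖LinearMap.toContinuousLinearMap (Matrix.toEuclideanLin A)‖

/-- The Hessian matrix `ψ''`. -/
def hess {d : ℕ} (ψ : E d → ℝ) (r : E d) : Matrix (Fin d) (Fin d) ℝ :=
  Matrix.of fun i j => (fderiv ℝ (gradient ψ) r (EuclideanSpace.single j 1)) i

/-- The objects of the model, with predictors in `ℝ^(q+1)` and responses on the unit sphere of
`ℝ^d`.  What they have to satisfy is stated in the predicates below: `condDens θ` is the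
conditional density of `Y` given the index, `link θ` is the pointwise minimizer of the conditional
risk, `condMean` is the conditional mean of `X` given the index at `θ₀`. -/
structure Model (q d : ℕ) where
  /-- the compact set of predictor values -/
  predictors : Set (E (q + 1))
  /-- the joint law `F₀` of `(X, Y)` -/
  law : Measure (E (q + 1) × Sph d)
  /-- the loss function `ψ` -/
  loss : E d → ℝ
  /-- the true parameter `θ₀` -/
  trueParam : E q
  /-- `f_θ(y | u)`, as a function of `θ`, `u`, `y` -/
  condDens : E q → ℝ → Sph d → ℝ
  /-- `μ_θ(u)` -/
  link : E q → ℝ → E d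
  /-- `E[X | U_{θ₀} = u]` -/
  condMean : ℝ → E (q + 1)

namespace Model

variable {q d : ℕ} (M : Model q d)

/-- The law of the index `U_θ`. -/
def indexLaw (θ : E q) : Measure ℝ := M.law.map (fun z => index θ z.1)

/-- The support `𝒰_θ` of `U_θ`. -/
def indexSupp (θ : E q) : Set ℝ := (M.indexLaw θ).support

/-- All `(θ, u)` with `θ ∈ Θ` and `u ∈ 𝒰_θ`. -/
def domain : Set (E q × ℝ) := {w | w.1 ∈ Param q ∧ w.2 ∈ M.indexSupp w.1}

/-- `E[h(Y) | U_θ = u]`, computed from the conditional density. -/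
def condExpY (θ : E q) (u : ℝ) (h : Sph d → ℝ) : ℝ :=
  ∫ y, h y * M.condDens θ u y ∂(surf d)

/-- The residual `y - μ_θ(u)`. -/
def resid (θ : E q) (u : ℝ) (y : Sph d) : E d := (y : E d) - M.link θ u

/-- `μ'_θ(u)`, the derivative of the link function in `u` along its domain `𝒰_θ`. -/
def linkDeriv (θ : E q) (u : ℝ) : E d := derivWithin (M.link θ) (M.indexSupp θ) u

/-- `G(u; θ) = E[ψ'(Y - μ_θ(u)) ψ'(Y - μ_θ(u))ᵀ | U_θ = u]`. -/
def G (θ : E q) (u : ℝ) : Matrix (Fin d) (Fin d) ℝ :=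
  Matrix.of fun i j => M.condExpY θ u
    (fun y => gradient M.loss (M.resid θ u y) i * gradient M.loss (M.resid θ u y) j)

/-- `F(u; θ) = E[ψ''(Y - μ_θ(u)) | U_θ = u]`. -/
def F (θ : E q) (u : ℝ) : Matrix (Fin d) (Fin d) ℝ :=
  Matrix.of fun i j => M.condExpY θ u (fun y => hess M.loss (M.resid θ u y) i j)

/-- `ζ_θ(t | u) = E[ψ(Y - μ_θ(u) + t) | U_θ = u]`. -/
def zeta (θ : E q) (u : ℝ) (t : E d) : ℝ :=
  M.condExpY θ u (fun y => M.loss (M.resid θ u y + t))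

/-- The risk `E_P[ψ(Y - μ_θ(U_θ))]` of the parameter `θ` under a law `P` of `(X, Y)`. -/
def risk (P : Measure (E (q + 1) × Sph d)) (θ : E q) : ℝ :=
  ∫ z, M.loss (M.resid θ (index θ z.1) z.2) ∂P

/-- `X - E[X | U_{θ₀}]`, at the predictor value `x`. -/
def centered (x : E (q + 1)) : E (q + 1) := x - M.condMean (index M.trueParam x)

/-- The conditional covariance matrix of `X` given `U_{θ₀}`, as a function of `z = (x, y)`. -/
def condCov (z : E (q + 1) × Sph d) : Matrix (Fin (q + 1)) (Fin (q + 1)) ℝ :=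
  Matrix.of fun i j =>
    (M.law[fun z' => M.centered z'.1 i * M.centered z'.1 j |
      MeasurableSpace.comap (fun z' : E (q + 1) × Sph d => index M.trueParam z'.1)
        inferInstance]) z

/-- `W₀ = E[μ'_{θ₀}(U)ᵀ F(U; θ₀) μ'_{θ₀}(U) · J(θ₀)ᵀ Σ_{X|U} J(θ₀)]` with `U = U_{θ₀}`. -/
def W0 : Matrix (Fin q) (Fin q) ℝ :=
  Matrix.of fun a b => ∫ z,
    ((M.linkDeriv M.trueParam (index M.trueParam z.1)).ofLp ⬝ᵥ
      (M.F M.trueParam (index M.trueParam z.1) *ᵥ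
        (M.linkDeriv M.trueParam (index M.trueParam z.1)).ofLp)) *
      (((jac M.trueParam)ᵀ * M.condCov z * jac M.trueParam) a b) ∂M.law

/-! ### The model -/

/-- `condDens θ u` is a version, defined at every `u ∈ 𝒰_θ`, of the conditional density of `Y`
given `U_θ = u` with respect to the surface measure. -/
def IsCondDens : Prop :=
  ∀ θ ∈ Param q,
    Measurable (Function.uncurry (M.condDens θ)) ∧
    (∀ u ∈ M.indexSupp θ, (∀ y, 0 ≤ M.condDens θ u y) ∧ ∫ y, M.condDens θ u y ∂(surf d) = 1) ∧
    M.law.map (fun z => (index θ z.1, z.2)) =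
      ((M.indexLaw θ).prod (surf d)).withDensity
        (fun w => ENNReal.ofReal (M.condDens θ w.1 w.2))

/-- `μ_θ(u)` minimizes `E[ψ(Y - m) | U_θ = u]` over `m ∈ ℝ^d`. -/
def IsLink : Prop :=
  ∀ θ ∈ Param q, ∀ u ∈ M.indexSupp θ,
    IsMinOn (fun m : E d => M.condExpY θ u (fun y => M.loss ((y : E d) - m))) univ (M.link θ u)

/-- The link functions are continuously differentiable in `(θ, u)`. -/
def SmoothLink : Prop := ContDiffOn ℝ 1 (Function.uncurry M.link) M.domain

/-- `θ₀ ∈ Θ` minimizes `E[ψ(Y - μ_θ(U_θ))]` over `Θ`. -/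
def IsTrueParam : Prop :=
  M.trueParam ∈ Param q ∧ IsMinOn (M.risk M.law) (Param q) M.trueParam

/-- `condMean` is the continuous version of `u ↦ E[X | U_{θ₀} = u]`. -/
def IsCondMean : Prop :=
  ContinuousOn M.condMean (M.indexSupp M.trueParam) ∧
  (fun z => M.condMean (index M.trueParam z.1)) =ᵐ[M.law]
    M.law[fun z => z.1 | MeasurableSpace.comap
      (fun z : E (q + 1) × Sph d => index M.trueParam z.1) inferInstance]

/-- The mean curve on the sphere, `μ_{θ₀}(u) / ‖μ_{θ₀}(u)‖`. -/
def meanCurve (u : ℝ) : E d := ‖M.link M.trueParam u‖⁻¹ • M.link M.trueParam u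

/-- The conditional density of `Y` given `X` is `c · f(κ yᵀ μ̃(U_{θ₀}))` for some angular
function `f` and some normalization constant `c`. -/
def InConcentrationClass (κ : ℝ) : Prop :=
  (∀ u ∈ M.indexSupp M.trueParam, M.link M.trueParam u ≠ 0) ∧
  ∃ (f : ℝ → ℝ) (c : ℝ), Measurable f ∧ (∀ t ∈ Icc (-κ) κ, 0 ≤ f t) ∧ 0 < c ∧
    M.law = ((M.law.map Prod.fst).prod (surf d)).withDensity (fun z =>
      ENNReal.ofReal
        (c * f (κ * inner ℝ (z.2 : E d) (M.meanCurve (index M.trueParam z.1)))))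

/-! ### Assumptions (A1)-(A5) -/

/-- `X` lies in a compact set `𝒳`, whose points have their index in `𝒰_θ`, and `U_θ` has a
density that is positive in the interior of `𝒰_θ` and twice continuously differentiable on
`𝒰_θ`. -/
def A1 : Prop :=
  IsCompact M.predictors ∧ (∀ᵐ z ∂M.law, z.1 ∈ M.predictors) ∧
  ∀ θ ∈ Param q,
    (∀ x ∈ M.predictors, index θ x ∈ M.indexSupp θ) ∧
    ∃ g : ℝ → ℝ,
      M.indexLaw θ =
        (volume.restrict (M.indexSupp θ)).withDensity (fun u => ENNReal.ofReal (g u)) ∧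
      (∀ u ∈ interior (M.indexSupp θ), 0 < g u) ∧
      ContDiffOn ℝ 2 g (M.indexSupp θ)

/-- `θ ↦ μ_θ(xᵀβ(θ))` is Lipschitz, uniformly in `x ∈ 𝒳` (it is enough to have this on compact
subsets of `Θ`), and `θ₀` is identified. -/
def A2 : Prop :=
  (∀ K ⊆ Param q, IsCompact K → ∃ L : ℝ, 0 < L ∧
    ∀ x ∈ M.predictors, ∀ θ₁ ∈ K, ∀ θ₂ ∈ K,
      ‖M.link θ₁ (index θ₁ x) - M.link θ₂ (index θ₂ x)‖ ≤ L * ‖θ₁ - θ₂‖) ∧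
  ∀ θ ∈ Param q, θ ≠ M.trueParam →
    0 < M.law {z | M.link θ (index θ z.1) ≠ M.link M.trueParam (index M.trueParam z.1)}

/-- The loss has a gradient and a Hessian, and `G` and `F` are continuous and positive definite.
Twice continuously differentiable losses qualify; so that, for instance, Huber's loss and
Tukey's biweight also do, it is only required that near every residual the gradient exists and
is Lipschitz, and that the Hessian exists at almost every residual. -/
def A3 : Prop :=
  Continuous M.loss ∧
  (∀ θ ∈ Param q, ∀ u ∈ M.indexSupp θ,
    (∀ y : Sph d, ∃ s ∈ 𝓝 (M.resid θ u y), (∀ r ∈ s, DifferentiableAt ℝ M.loss r) ∧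
      ∃ K, LipschitzOnWith K (gradient M.loss) s) ∧
    (∀ᵐ y ∂(surf d), 0 < M.condDens θ u y →
      DifferentiableAt ℝ (gradient M.loss) (M.resid θ u y))) ∧
  ContinuousOn (Function.uncurry M.G) M.domain ∧
  ContinuousOn (Function.uncurry M.F) M.domain ∧
  ∀ θ ∈ Param q, ∀ u ∈ M.indexSupp θ, (M.G θ u).PosDef ∧ (M.F θ u).PosDef

/-- `ζ_θ(· | u)` has its unique minimizer at the origin and is twice continuously differentiable;
for small `t`, it and its first two derivatives are locally continuous in `u` and bounded. -/
def A4 : Prop :=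
  ∀ θ ∈ Param q, ∀ u ∈ M.indexSupp θ,
    (∀ t, t ≠ 0 → M.zeta θ u 0 < M.zeta θ u t) ∧
    ContDiff ℝ 2 (M.zeta θ u) ∧
    ∃ ρ > 0, ∃ B : ℝ, ∀ t : E d, ‖t‖ < ρ → ∀ k : ℕ, k ≤ 2 →
      ContinuousOn (fun v => iteratedFDeriv ℝ k (M.zeta θ v) t)
        (M.indexSupp θ ∩ Metric.ball u ρ) ∧
      ∀ v ∈ M.indexSupp θ ∩ Metric.ball u ρ, ‖iteratedFDeriv ℝ k (M.zeta θ v) t‖ ≤ B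

/-- `f_θ(y | u)` is continuous in `u` and locally dominated by a function `g` with the two
integrability properties. -/
def A5 : Prop :=
  ∀ θ ∈ Param q,
    (∀ y, ContinuousOn (fun u => M.condDens θ u y) (M.indexSupp θ)) ∧
    ∀ u ∈ M.indexSupp θ, ∃ ε > 0, ∃ δ > 0, ∃ g : Sph d → ℝ,
      (∀ y, 0 < g y) ∧
      (∀ v ∈ M.indexSupp θ, |v - u| ≤ ε → ∀ y, M.condDens θ v y ≤ g y) ∧
      Integrable (fun y => ‖gradient M.loss (M.resid θ u y)‖ ^ (2 + δ : ℝ) * g y) (surf d) ∧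
      (∀ᶠ t in 𝓝 (0 : E d), Integrable (fun y : Sph d =>
        (M.loss ((y : E d) - t) - M.loss y + inner ℝ t (gradient M.loss y)) ^ 2 * g y)
          (surf d)) ∧
      (fun t : E d => ∫ y : Sph d,
        (M.loss ((y : E d) - t) - M.loss y + inner ℝ t (gradient M.loss y)) ^ 2 * g y
          ∂(surf d)) =o[𝓝 0] (fun t => ‖t‖ ^ 2)

/-! ### The influence function -/

/-- The contaminated law `(1 - ε) F₀ + ε δ_z`. -/
def contaminated (z : E (q + 1) × Sph d) (ε : ℝ) : Measure (E (q + 1) × Sph d) :=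
  ENNReal.ofReal (1 - ε) • M.law + ENNReal.ofReal ε • Measure.dirac z

/-- `θ` minimizes the risk under the law `P` over the closed ball of radius `r` around `θ₀`. -/
def IsLocalMEst (r : ℝ) (P : Measure (E (q + 1) × Sph d)) (θ : E q) : Prop :=
  θ ∈ Metric.closedBall M.trueParam r ∧ IsMinOn (M.risk P) (Metric.closedBall M.trueParam r) θ

/-- `v` is the value at `z` of the influence function of the M-functional
`T(P) = argmin_θ E_P[ψ(Y - μ_θ(U_θ))]`, the minimum being taken near `θ₀`: for every small enough
ball around `θ₀`, the minimum is attained under `(1 - ε) F₀ + ε δ_z` when `ε ≥ 0` is small, and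
every choice `T ε` of the minimizers satisfies `T 0 = θ₀` and `(T ε - T 0) / ε → v`
as `ε ↓ 0`. -/
def HasInfluenceAt (z : E (q + 1) × Sph d) (v : E q) : Prop :=
  ∀ᶠ r in 𝓝[>] (0 : ℝ),
    (∀ᶠ ε in 𝓝[≥] (0 : ℝ), ∃ θ, M.IsLocalMEst r (M.contaminated z ε) θ) ∧
    ∀ T : ℝ → E q, (∀ᶠ ε in 𝓝[≥] (0 : ℝ), M.IsLocalMEst r (M.contaminated z ε) (T ε)) →
      T 0 = M.trueParam ∧
      Tendsto (fun ε : ℝ => ε⁻¹ • (T ε - T 0)) (𝓝[>] 0) (𝓝 v)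

open Classical in
/-- The influence function `IF(z; θ̂, F₀)` (with value `0` where it does not exist). -/
def influence (z : E (q + 1) × Sph d) : E q :=
  if h : ∃ v, M.HasInfluenceAt z v then h.choose else 0

/-- The set `𝒳 × 𝕊^(d-1)` of observations. -/
def observations : Set (E (q + 1) × Sph d) := {z | z.1 ∈ M.predictors}

/-- The gross error sensitivity, the supremum over `𝒳 × 𝕊^(d-1)` of the norm of the influence
function. -/
def grossErrorSensitivity : ℝ≥0∞ := ⨆ z ∈ M.observations, ‖M.influence z‖ₑ

/-- The supremum of
`‖ψ'(y - μ_{θ₀}(u))‖ ‖μ'_{θ₀}(u)‖ ‖x - E[X | U_{θ₀} = u]‖`, `u = xᵀβ(θ₀)`,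
over `𝒳 × 𝕊^(d-1)`. -/
def scoreBound : ℝ≥0∞ :=
  ⨆ z ∈ M.observations,
    ‖gradient M.loss (M.resid M.trueParam (index M.trueParam z.1) z.2)‖ₑ *
      ‖M.linkDeriv M.trueParam (index M.trueParam z.1)‖ₑ * ‖M.centered z.1‖ₑ

end Model

end

end SphericalSIM

/-! Contamination is a mixture, so the contaminated risk is `(1 - ε) R(θ) + ε s(θ)`, where `R` is
the risk under `F₀` and `s` is the loss of the single observation `z` (`Regular.risk_contaminated`).
If `θ₀` is the strict minimizer of `R` on a small ball, `R(θ₀ + h) = R(θ₀) + ½ hᵀ W h + o(‖h‖²)`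
with `W` positive definite, and `s` is differentiable at `θ₀`, then any minimizers move by `-ε W⁻¹
∇s(θ₀) + o(ε)`. This is `tendsto_slope_perturbed_min`; it compares values only, so no derivative of
`R` away from `θ₀` is needed.

It remains to identify `W` and `∇s(θ₀)`, and both rest on the derivative of `θ ↦ μ_θ(xᵀβ(θ))` at
`θ₀`. By the chain rule in direction `η`, it is the partial derivative of `μ_θ(u)` in `θ`, a
function of `u` alone, plus `(xᵀJη) μ'(u)`. The partial derivative is found implicitly. For every
`θ` and test function `φ`, the pointwise minimality of the links gives `E[φ(U_θ) ψ'(Y - μ_θ(U_θ))] =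
0`. The law of `Y` given `X` depends on `X` through `U_{θ₀}` only (`Regular.law_eq`), so the average
over `Y` can be taken at fixed `x` with a density free of `θ`, and the equation can be
differentiated at `θ₀`. The result says that `F(U)` times the path derivative has conditional mean
zero given `U`; as `F` is positive definite, the partial derivative is `-(E[X|U=u]ᵀJη) μ'(u)`
(`Regular.linkParamDeriv_eq`). Hence the path derivative is `((x - E[X|U=u])ᵀJη) μ'(u)`
(`Regular.pathDeriv_eq`), the source of the centring in the influence function.

Inserting this in the second-order expansion of the conditional risk `ζ` and integrating gives `W =
W₀` (`Regular.isLittleO_risk`, `Regular.inner_W0`), which is positive semidefinite and invertible,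
hence definite. The chain rule gives `∇s(θ₀) = -(ψ'ᵀμ') Jᵀ(x - E[X|U=u])`. Finiteness of the
sensitivity is compactness: every factor of the score is continuous on a compact set. -/

namespace SphericalSIM

/-! ### Second-order expansions and perturbed minimizers -/

section Analysis

variable {V : Type*} [NormedAddCommGroup V] [InnerProductSpace ℝ V]

/-- Second-order Taylor expansion of a function whose gradient is differentiable at a point. -/
theorem isLittleO_taylor_two [CompleteSpace V] {f : V → ℝ} {g : V → V} {H : V →L[ℝ] V} {a : V}
    (hf : ∀ᶠ x in 𝓝 a, HasGradientAt f (g x) x) (hg : HasFDerivAt g H a) :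
    (fun t : V => f (a + t) - f a - inner ℝ (g a) t - 1 / 2 * inner ℝ (H t) t)
      =o[𝓝 0] fun t => ‖t‖ ^ 2 := by
  rw [Asymptotics.isLittleO_iff]
  intro c hc
  have h1 := (hasFDerivAt_iff_isLittleO_nhds_zero.1 hg).def hc
  have h2 : ∀ᶠ t in 𝓝 (0 : V), HasGradientAt f (g (a + t)) (a + t) := by
    have : Tendsto (fun t : V => a + t) (𝓝 0) (𝓝 a) := by
      simpa using (continuous_const.add continuous_id).tendsto (X := V) (0 : V) (f := fun t => a + t)
    exact this.eventually hf
  obtain ⟨ρ, hρ, hball⟩ := Metric.eventually_nhds_iff_ball.1 (h1.and h2)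
  filter_upwards [Metric.ball_mem_nhds (0 : V) hρ] with t ht
  have hin : ∀ s ∈ Icc (0 : ℝ) 1, s • t ∈ Metric.ball (0 : V) ρ := by
    intro s hs
    rw [mem_ball_zero_iff] at ht ⊢
    rw [norm_smul, Real.norm_of_nonneg hs.1]
    nlinarith [hs.2, norm_nonneg t]
  -- The Taylor remainder along the segment from `a` to `a + t`. Its derivative is the first-order
  -- error of `g`, so the mean value inequality suffices and `g` need be differentiable only at `a`.
  let φ : ℝ → ℝ := fun s => f (a + s • t) - s * inner ℝ (g a) t - s ^ 2 / 2 * inner ℝ (H t) t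
  have hφ : ∀ s ∈ Icc (0 : ℝ) 1, HasDerivWithinAt φ
      (inner ℝ (g (a + s • t)) t - inner ℝ (g a) t - s * inner ℝ (H t) t) (Icc 0 1) s := by
    intro s hs
    have hline : HasDerivAt (fun s : ℝ => a + s • t) t s := by
      simpa using ((hasDerivAt_id s).smul_const t).const_add a
    have hd := (hball _ (hin s hs)).2.hasFDerivAt.comp_hasDerivAt s hline
    have hd2 : HasDerivAt (fun s : ℝ => s ^ 2 / 2) s s := by
      have := (hasDerivAt_pow 2 s).div_const 2
      simpa using this
    have := ((hd.sub ((hasDerivAt_id s).mul_const (inner ℝ (g a) t))).sub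
      (hd2.mul_const (inner ℝ (H t) t)))
    refine HasDerivAt.hasDerivWithinAt (this.congr_deriv ?_)
    simp
  have hbd : ∀ s ∈ Ico (0 : ℝ) 1,
      ‖inner ℝ (g (a + s • t)) t - inner ℝ (g a) t - s * inner ℝ (H t) t‖ ≤ c * ‖t‖ ^ 2 := by
    intro s hs
    have h3 := (hball _ (hin s ⟨hs.1, hs.2.le⟩)).1
    have h4 : inner ℝ (g (a + s • t)) t - inner ℝ (g a) t - s * inner ℝ (H t) t
        = inner ℝ (g (a + s • t) - g a - H (s • t)) t := by
      simp [inner_sub_left, inner_smul_left]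
    rw [h4]
    refine (norm_inner_le_norm _ _).trans ?_
    rw [norm_smul, Real.norm_of_nonneg hs.1] at h3
    calc _ ≤ (c * (s * ‖t‖)) * ‖t‖ := by gcongr
      _ = c * ‖t‖ ^ 2 * s := by ring
      _ ≤ c * ‖t‖ ^ 2 * 1 := by gcongr; exact hs.2.le
      _ = _ := by ring
  have := norm_image_sub_le_of_norm_deriv_le_segment_01' hφ hbd
  simp only [φ] at this
  simp only [one_smul, zero_smul, add_zero, one_mul, zero_mul] at this
  rw [Real.norm_of_nonneg (sq_nonneg ‖t‖)]
  have hφ1 : f (a + t) - f a - inner ℝ (g a) t - 1 / 2 * inner ℝ (H t) t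
      = f (a + t) - inner ℝ (g a) t - 1 ^ 2 / 2 * inner ℝ (H t) t
        - (f a - 0 - 0 ^ 2 / 2 * inner ℝ (H t) t) := by ring
  rw [hφ1]
  exact this

/-- A positive definite continuous quadratic form on a finite-dimensional space is coercive. -/
theorem exists_coercive [FiniteDimensional ℝ V] {Q : V → ℝ} (hQ : Continuous Q)
    (hsmul : ∀ (s : ℝ) h, Q (s • h) = s ^ 2 * Q h) (hpos : ∀ h, h ≠ 0 → 0 < Q h) :
    ∃ c > 0, ∀ h, c * ‖h‖ ^ 2 ≤ Q h := by
  have hzero : Q 0 = 0 := by simpa using hsmul 0 0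
  -- The unit sphere is empty when `V` is trivial, which happens here for `p = 1`.
  rcases (Metric.sphere (0 : V) 1).eq_empty_or_nonempty with he | hne
  · refine ⟨1, one_pos, fun h => ?_⟩
    by_cases hh : h = 0
    · simp [hh, hzero]
    · exfalso
      have : (‖h‖⁻¹ • h) ∈ Metric.sphere (0 : V) 1 := by
        simp [norm_smul, norm_ne_zero_iff.2 hh]
      rw [he] at this
      exact this
  · obtain ⟨e, he, hmin⟩ := (isCompact_sphere (0 : V) 1).exists_isMinOn hne hQ.continuousOn
    have he0 : e ≠ 0 := by rintro rfl; simp at he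
    refine ⟨Q e, hpos e he0, fun h => ?_⟩
    by_cases hh : h = 0
    · simp [hh, hzero]
    · have hn : ‖h‖ ≠ 0 := norm_ne_zero_iff.2 hh
      have hm : Q e ≤ Q (‖h‖⁻¹ • h) := hmin (by simp [norm_smul, hn])
      rw [hsmul] at hm
      have : Q h = ‖h‖ ^ 2 * ((‖h‖⁻¹) ^ 2 * Q h) := by field_simp
      rw [this]
      nlinarith [sq_nonneg ‖h‖]

/-- Minimizers of `(1 - ε) R + ε s` over a compact set converge to the unique minimizer of `R`. -/
theorem tendsto_of_perturbed_min {X : Type*} [TopologicalSpace X] {B : Set X}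
    (hB : IsCompact B) {R s : X → ℝ} (hR : ContinuousOn R B) (hs : ContinuousOn s B)
    {a : X} (ha : a ∈ B) (hmin : ∀ x ∈ B, x ≠ a → R a < R x) {T : ℝ → X}
    (hT : ∀ᶠ ε in 𝓝[>] (0 : ℝ), T ε ∈ B ∧
      ∀ x ∈ B, (1 - ε) * R (T ε) + ε * s (T ε) ≤ (1 - ε) * R x + ε * s x) :
    Tendsto T (𝓝[>] 0) (𝓝 a) := by
  obtain ⟨S, hS⟩ := hB.exists_bound_of_continuousOn hs
  rw [tendsto_nhds]
  intro O hO haO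
  have hC : IsCompact (B \ O) := hB.diff hO
  have hgap : ∃ m > 0, ∀ x ∈ B \ O, R a + m ≤ R x := by
    rcases (B \ O).eq_empty_or_nonempty with he | hne
    · exact ⟨1, one_pos, by simp [he]⟩
    · obtain ⟨e, he, hm⟩ := hC.exists_isMinOn hne (hR.mono sdiff_subset)
      have : R a < R e := hmin e he.1 (by rintro rfl; exact he.2 haO)
      exact ⟨R e - R a, by linarith, fun x hx => by have := hm hx; simp at this; linarith⟩
  obtain ⟨m, hm, hgap⟩ := hgap
  -- Leaving `O` costs at least `(1 - ε) m` in the first term, while `ε s` can gain at most `2 S ε`.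
  have hlim : Tendsto (fun ε : ℝ => (1 - ε) * m - ε * (2 * S)) (𝓝[>] 0) (𝓝 m) := by
    have : Continuous (fun ε : ℝ => (1 - ε) * m - ε * (2 * S)) := by fun_prop
    simpa using (this.tendsto 0).mono_left nhdsWithin_le_nhds
  have hlt1 : ∀ᶠ ε in 𝓝[>] (0 : ℝ), ε < 1 := nhdsWithin_le_nhds (eventually_lt_nhds one_pos)
  filter_upwards [hT, hlim.eventually (lt_mem_nhds hm), self_mem_nhdsWithin, hlt1] with ε h1 h2 h3 h4
  by_contra hmem
  have h5 := hgap (T ε) ⟨h1.1, hmem⟩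
  have h6 := h1.2 a ha
  have h7 := abs_le.1 (hS (T ε) h1.1)
  have h8 := abs_le.1 (hS a ha)
  have h3' : (0 : ℝ) < ε := h3
  nlinarith [mul_le_mul_of_nonneg_left h5 (by linarith : (0 : ℝ) ≤ 1 - ε),
    mul_le_mul_of_nonneg_left h7.1 h3'.le, mul_le_mul_of_nonneg_left h8.2 h3'.le]

/-- The derivative at `ε = 0` of the minimizers of `(1 - ε) R + ε s`. -/
theorem tendsto_slope_perturbed_min [FiniteDimensional ℝ V] {B : Set V} (hB : IsCompact B)
    {R s : V → ℝ} (hR : ContinuousOn R B) (hs : ContinuousOn s B) {a : V} (ha : B ∈ 𝓝 a)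
    (hmin : ∀ x ∈ B, x ≠ a → R a < R x) {W : V →L[ℝ] V}
    (hsymm : ∀ h k, inner ℝ (W h) k = inner ℝ h (W k)) {c : ℝ} (hc : 0 < c)
    (hcoer : ∀ h, c * ‖h‖ ^ 2 ≤ inner ℝ (W h) h)
    (hRexp : (fun h => R (a + h) - R a - 1 / 2 * inner ℝ (W h) h) =o[𝓝 0] fun h => ‖h‖ ^ 2)
    {g v : V} (hsg : HasGradientAt s g a) (hv : W v = -g) {T : ℝ → V}
    (hT : ∀ᶠ ε in 𝓝[>] (0 : ℝ), T ε ∈ B ∧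
      ∀ x ∈ B, (1 - ε) * R (T ε) + ε * s (T ε) ≤ (1 - ε) * R x + ε * s x) :
    Tendsto (fun ε : ℝ => ε⁻¹ • (T ε - a)) (𝓝[>] 0) (𝓝 v) := by
  have hlim := tendsto_of_perturbed_min hB hR hs (mem_of_mem_nhds ha) hmin hT
  have hh : Tendsto (fun ε => T ε - a) (𝓝[>] 0) (𝓝 0) := by
    simpa using hlim.sub_const a
  have hid : Tendsto (fun ε : ℝ => ε) (𝓝[>] 0) (𝓝 0) := nhdsWithin_le_nhds
  have hεv : Tendsto (fun ε : ℝ => ε • v) (𝓝[>] 0) (𝓝 0) := by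
    simpa using hid.smul_const v
  have hsexp : (fun h => s (a + h) - s a - inner ℝ g h) =o[𝓝 0] fun h => h := by
    have := hasFDerivAt_iff_isLittleO_nhds_zero.1 hsg.hasFDerivAt
    simpa using this
  have hpos : ∀ᶠ ε in 𝓝[>] (0 : ℝ), 0 < ε := self_mem_nhdsWithin
  have hlt : ∀ᶠ ε in 𝓝[>] (0 : ℝ), ε < 1 / 2 :=
    nhdsWithin_le_nhds (eventually_lt_nhds (by norm_num))
  have hB' : ∀ᶠ ε in 𝓝[>] (0 : ℝ), a + ε • v ∈ B := by
    have : Tendsto (fun ε : ℝ => a + ε • v) (𝓝[>] 0) (𝓝 a) := by simpa using hεv.const_add a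
    exact this ha
  -- the minimizers deviate by `O(ε)`
  have hO : ∃ C > 0, ∀ᶠ ε in 𝓝[>] (0 : ℝ), ‖T ε - a‖ ≤ C * ε := by
    -- Coercivity gives `c/2 · n²`; the error in the expansion of `R` takes away `c/4 · n²` and the
    -- weight `1 - ε ≥ 1/2` halves the rest, leaving `c/8 · n²` against a gain of at most `ε (‖g‖ +
    -- 1) n`.
    refine ⟨8 / c * (‖g‖ + 1), by positivity, ?_⟩
    filter_upwards [hT, hpos, hlt, hh.eventually (hRexp.def (by positivity : (0 : ℝ) < c / 4)),
      hh.eventually (hsexp.def one_pos)] with ε h1 h2 h3 h4 h5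
    have h6 := h1.2 a (mem_of_mem_nhds ha)
    have h7 := hcoer (T ε - a)
    simp only [add_sub_cancel, norm_pow, Real.norm_eq_abs, abs_norm, one_mul] at h4 h5
    have h4' := (abs_le.1 h4).1
    have h5' := (abs_le.1 h5).1
    have h8 := abs_le.1 (abs_real_inner_le_norm g (T ε - a))
    set n := ‖T ε - a‖
    have hn : 0 ≤ n := norm_nonneg _
    have hRlow : c / 4 * n ^ 2 ≤ R (T ε) - R a := by nlinarith
    have h9 : (1 - ε) * (c / 4 * n ^ 2) ≤ ε * ((‖g‖ + 1) * n) := by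
      nlinarith [mul_le_mul_of_nonneg_left hRlow (by linarith : (0 : ℝ) ≤ 1 - ε),
        mul_le_mul_of_nonneg_left h5' h2.le, mul_le_mul_of_nonneg_left h8.1 h2.le]
    have h10 : n * (c / 8 * n) ≤ n * (ε * (‖g‖ + 1)) := by
      nlinarith [mul_nonneg (by positivity : 0 ≤ c / 4 * n ^ 2) (by linarith : 0 ≤ 1 / 2 - ε)]
    rcases hn.eq_or_lt with h0 | h0
    · rw [← h0]; positivity
    · have := le_of_mul_le_mul_left h10 h0
      rw [div_mul_eq_mul_div, div_mul_eq_mul_div, le_div_iff₀ hc]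
      nlinarith
  obtain ⟨C, hC, hO⟩ := hO
  rw [Metric.tendsto_nhds]
  intro η hη
  -- the size of the admissible error
  set A := (2 * C + 2 * ‖v‖ + 1) ^ 2 + ‖W‖ * (C ^ 2 + ‖v‖ ^ 2) + 1 with hA
  have hA0 : 0 < A := by positivity
  -- The tolerance in all four expansions and also a bound on `ε`. Since `2 · e · 2A = c η² / 4`,
  -- the final estimate becomes `‖h - ε • v‖ ≤ ε η / 2`.
  set e := c * η ^ 2 / (8 * A * 2) with he
  have he0 : 0 < e := by positivity
  have hlt2 : ∀ᶠ ε in 𝓝[>] (0 : ℝ), ε < e :=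
    nhdsWithin_le_nhds (eventually_lt_nhds he0)
  filter_upwards [hT, hpos, hlt, hlt2, hO, hB', hh.eventually (hRexp.def he0),
    hεv.eventually (hRexp.def he0), hh.eventually (hsexp.def he0),
    hεv.eventually (hsexp.def he0)] with ε h1 h2 h3 h3' h4 h5 h6 h7 h8 h9
  -- The competitor `a + ε • v` minimizes the quadratic model `½⟪W h, h⟫ + ε⟪g, h⟫`, because `W v =
  -- -g`.
  have hmin' := h1.2 _ h5
  simp only [add_sub_cancel, norm_pow, Real.norm_eq_abs, abs_norm, norm_smul,
    abs_of_pos h2] at h6 h7 h8 h9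
  set h := T ε - a with hh'
  have hWh : |inner ℝ (W h) h| ≤ ‖W‖ * ‖h‖ ^ 2 := by
    refine (abs_real_inner_le_norm _ _).trans ?_
    nlinarith [W.le_opNorm h, norm_nonneg h]
  have hWv : |inner ℝ (W v) v| ≤ ‖W‖ * ‖v‖ ^ 2 := by
    refine (abs_real_inner_le_norm _ _).trans ?_
    nlinarith [W.le_opNorm v, norm_nonneg v]
  have hn0 : ‖h‖ ^ 2 ≤ C ^ 2 * ε ^ 2 := by
    rw [← mul_pow]; exact pow_le_pow_left₀ (norm_nonneg _) h4 2
  -- Completing the square: this is twice the excess of the quadratic model at `h` over its minimum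
  -- at `ε • v`.
  have hquad : inner ℝ (W (h - ε • v)) (h - ε • v)
      = inner ℝ (W h) h + 2 * ε * inner ℝ g h + ε ^ 2 * inner ℝ (W v) v := by
    have e1 : inner ℝ (W h) v = -inner ℝ g h := by
      rw [hsymm, hv, inner_neg_right, real_inner_comm]
    have e2 : inner ℝ (W v) h = -inner ℝ g h := by rw [hv, inner_neg_left]
    simp only [map_sub, map_smul, inner_sub_left, inner_sub_right, inner_smul_left,
      inner_smul_right, e1, e2]
    simp
    ring
  have hgv : inner ℝ g (ε • v) = -(ε * inner ℝ (W v) v) := by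
    rw [inner_smul_right, hv, inner_neg_left]; ring
  have hWεv : inner ℝ (W (ε • v)) (ε • v) = ε ^ 2 * inner ℝ (W v) v := by
    simp [inner_smul_left, inner_smul_right]; ring
  rw [hWεv, sq_abs] at h7
  rw [hgv] at h9
  set x := inner ℝ (W h) h
  set y := inner ℝ g h
  set w := inner ℝ (W v) v
  have h6' := abs_le.1 h6
  have h7' := abs_le.1 h7
  have h8' := abs_le.1 h8
  have h9' := abs_le.1 h9
  have hWh' := abs_le.1 hWh
  have hWv' := abs_le.1 hWv
  have hkey : 1 / 2 * (x + 2 * ε * y + ε ^ 2 * w) ≤ e * ε ^ 2 * (2 * A) := by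
    -- The weight `1 - ε` on `R` leaves third-order terms, `ε` times a quadratic one; they are
    -- absorbed through `ε < e`.
    have hx : ε * (1 / 2 * x) ≤ e * (‖W‖ * (C ^ 2 * ε ^ 2)) := by
      have : 1 / 2 * x ≤ ‖W‖ * (C ^ 2 * ε ^ 2) := by
        have j1 := mul_le_mul_of_nonneg_left hn0 (norm_nonneg W)
        have j2 := mul_nonneg (norm_nonneg W) (sq_nonneg ‖h‖)
        linarith [hWh'.2]
      calc _ ≤ ε * (‖W‖ * (C ^ 2 * ε ^ 2)) := by gcongr
        _ ≤ _ := by gcongr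
    have hw : -(e * (‖W‖ * (‖v‖ ^ 2 * ε ^ 2))) ≤ ε * (1 / 2 * (ε ^ 2 * w)) := by
      have : -(‖W‖ * (‖v‖ ^ 2 * ε ^ 2)) ≤ 1 / 2 * (ε ^ 2 * w) := by
        have j1 := mul_le_mul_of_nonneg_left hWv'.1 (sq_nonneg ε)
        have j2 := mul_nonneg (norm_nonneg W) (mul_nonneg (sq_nonneg ‖v‖) (sq_nonneg ε))
        linarith
      have h' : ε * -(‖W‖ * (‖v‖ ^ 2 * ε ^ 2)) ≤ ε * (1 / 2 * (ε ^ 2 * w)) := by gcongr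
      have h'' : ε * (‖W‖ * (‖v‖ ^ 2 * ε ^ 2)) ≤ e * (‖W‖ * (‖v‖ ^ 2 * ε ^ 2)) := by gcongr
      linarith
    have i1 : (1 - ε) * (R a + 1 / 2 * x - e * (C ^ 2 * ε ^ 2)) ≤ (1 - ε) * R (T ε) := by
      refine mul_le_mul_of_nonneg_left ?_ (by linarith)
      linarith [mul_le_mul_of_nonneg_left hn0 he0.le]
    have i2 : (1 - ε) * R (a + ε • v) ≤
        (1 - ε) * (R a + 1 / 2 * (ε ^ 2 * w) + e * (ε * ‖v‖) ^ 2) :=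
      mul_le_mul_of_nonneg_left (by linarith) (by linarith)
    have i3 : ε * (s a + y - e * (C * ε)) ≤ ε * s (T ε) := by
      refine mul_le_mul_of_nonneg_left ?_ h2.le
      linarith [mul_le_mul_of_nonneg_left h4 he0.le]
    have i4 : ε * s (a + ε • v) ≤ ε * (s a + -(ε * w) + e * (ε * ‖v‖)) :=
      mul_le_mul_of_nonneg_left (by linarith) h2.le
    have i5 : (1 - ε) * (e * (C ^ 2 * ε ^ 2)) ≤ e * (C ^ 2 * ε ^ 2) := by
      linarith [mul_nonneg h2.le (by positivity : 0 ≤ e * (C ^ 2 * ε ^ 2))]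
    have i6 : (1 - ε) * (e * (ε * ‖v‖) ^ 2) ≤ e * (ε * ‖v‖) ^ 2 := by
      linarith [mul_nonneg h2.le (by positivity : 0 ≤ e * (ε * ‖v‖) ^ 2)]
    have i7 : 1 / 2 * (x + 2 * ε * y + ε ^ 2 * w) ≤ e * ε ^ 2 *
        (C ^ 2 + ‖v‖ ^ 2 + C + ‖v‖ + ‖W‖ * C ^ 2 + ‖W‖ * ‖v‖ ^ 2) := by
      linarith
    refine i7.trans (mul_le_mul_of_nonneg_left ?_ (by positivity))
    rw [hA]
    have := norm_nonneg v
    have := mul_nonneg hC.le (norm_nonneg v)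
    have := mul_nonneg (norm_nonneg W) (sq_nonneg C)
    have := mul_nonneg (norm_nonneg W) (sq_nonneg ‖v‖)
    have := sq_nonneg C
    have := sq_nonneg ‖v‖
    linarith
  have hfin := hcoer (h - ε • v)
  rw [hquad] at hfin
  have hdist : dist (ε⁻¹ • h) v = ε⁻¹ * ‖h - ε • v‖ := by
    have : ε⁻¹ • h - v = ε⁻¹ • (h - ε • v) := by
      rw [smul_sub ε⁻¹ h (ε • v), smul_smul, inv_mul_cancel₀ h2.ne', one_smul]
    rw [dist_eq_norm, this, norm_smul, Real.norm_of_nonneg (inv_pos.2 h2).le]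
  rw [hdist, inv_mul_lt_iff₀ h2]
  refine lt_of_pow_lt_pow_left₀ 2 (by positivity) ?_
  have heA : e * (2 * A) = c * η ^ 2 / 8 := by rw [he]; field_simp
  have : c * ‖h - ε • v‖ ^ 2 ≤ c * (ε ^ 2 * η ^ 2 / 4) := by
    calc _ ≤ 2 * (e * ε ^ 2 * (2 * A)) := by linarith
      _ = 2 * ε ^ 2 * (e * (2 * A)) := by ring
      _ = _ := by rw [heA]; ring
  have := le_of_mul_le_mul_left this hc
  have : 0 < ε ^ 2 * η ^ 2 := by positivity
  rw [mul_pow]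
  linarith

end Analysis

/-! ### Averages of a loss function with locally Lipschitz gradient -/

section Averages

variable {V : Type*} [NormedAddCommGroup V] [InnerProductSpace ℝ V] [FiniteDimensional ℝ V]

/-- The loss `ψ` is differentiable with `C`-Lipschitz gradient on each ball of radius `δ` with
center in `K`. -/
def SmoothNear (ψ : V → ℝ) (K : Set V) (δ C : ℝ) : Prop :=
  ∀ r ∈ K, (∀ x ∈ Metric.ball r δ, DifferentiableAt ℝ ψ x) ∧
    ∀ x ∈ Metric.ball r δ, ∀ y ∈ Metric.ball r δ,
      ‖gradient ψ x - gradient ψ y‖ ≤ C * ‖x - y‖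

/-- A Lebesgue number argument: the property passes to subsets and finite unions, and halving a
radius makes it hold for all centres close to a given point. It makes the local smoothness in (A3)
uniform over all residuals. -/
theorem exists_smoothNear {ψ : V → ℝ} {K : Set V} (hK : IsCompact K)
    (h : ∀ r ∈ K, ∃ s ∈ 𝓝 r, (∀ x ∈ s, DifferentiableAt ℝ ψ x) ∧
      ∃ C, LipschitzOnWith C (gradient ψ) s) :
    ∃ δ > 0, ∃ C, 0 ≤ C ∧ SmoothNear ψ K δ C := by
  refine hK.induction_on (p := fun K => ∃ δ > 0, ∃ C, 0 ≤ C ∧ SmoothNear ψ K δ C) ?_ ?_ ?_ ?_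
  · exact ⟨1, one_pos, 0, le_rfl, by simp [SmoothNear]⟩
  · rintro s t hst ⟨δ, hδ, C, hC, h⟩
    exact ⟨δ, hδ, C, hC, fun r hr => h r (hst hr)⟩
  · rintro s t ⟨δ, hδ, C, hC, h⟩ ⟨δ', hδ', C', hC', h'⟩
    refine ⟨min δ δ', lt_min hδ hδ', max C C', hC.trans (le_max_left _ _), fun r hr => ?_⟩
    rcases hr with hr | hr
    · have hsub : Metric.ball r (min δ δ') ⊆ Metric.ball r δ :=
        Metric.ball_subset_ball (min_le_left _ _)
      refine ⟨fun x hx => (h r hr).1 x (hsub hx), fun x hx y hy => ?_⟩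
      exact ((h r hr).2 x (hsub hx) y (hsub hy)).trans (by gcongr; exact le_max_left _ _)
    · have hsub : Metric.ball r (min δ δ') ⊆ Metric.ball r δ' :=
        Metric.ball_subset_ball (min_le_right _ _)
      refine ⟨fun x hx => (h' r hr).1 x (hsub hx), fun x hx y hy => ?_⟩
      exact ((h' r hr).2 x (hsub hx) y (hsub hy)).trans (by gcongr; exact le_max_right _ _)
  · intro r hr
    obtain ⟨s, hs, hd, C, hC⟩ := h r hr
    obtain ⟨ε, hε, hball⟩ := Metric.mem_nhds_iff.1 hs
    refine ⟨Metric.ball r (ε / 2), mem_nhdsWithin_of_mem_nhds (Metric.ball_mem_nhds _ (by positivity)),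
      ε / 2, by positivity, C, C.2, fun r' hr' => ?_⟩
    have hsub : Metric.ball r' (ε / 2) ⊆ s := by
      refine subset_trans (fun x hx => ?_) hball
      rw [Metric.mem_ball] at *
      linarith [dist_triangle x r' r]
    exact ⟨fun x hx => hd x (hsub hx), fun x hx y hy => hC.norm_sub_le (hsub hx) (hsub hy)⟩

theorem SmoothNear.mono {ψ : V → ℝ} {K K' : Set V} {δ C : ℝ} (h : SmoothNear ψ K δ C)
    (hK : K' ⊆ K) : SmoothNear ψ K' δ C := fun r hr => h r (hK hr)

theorem SmoothNear.continuousAt {ψ : V → ℝ} {K : Set V} {δ C : ℝ} (h : SmoothNear ψ K δ C)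
    {r x : V} (hr : r ∈ K) (hx : x ∈ Metric.ball r δ) : ContinuousAt (gradient ψ) x := by
  have hlip : LipschitzOnWith (Real.toNNReal C) (gradient ψ) (Metric.ball r δ) :=
    LipschitzOnWith.of_dist_le_mul fun x hx y hy => by
      rw [dist_eq_norm, dist_eq_norm]
      refine ((h r hr).2 x hx y hy).trans ?_
      gcongr
      exact Real.le_coe_toNNReal C
  exact hlip.continuousOn.continuousAt (Metric.isOpen_ball.mem_nhds hx)

theorem measurable_gradient [MeasurableSpace V] [BorelSpace V] (ψ : V → ℝ) :
    Measurable (gradient ψ) :=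
  (InnerProductSpace.toDual ℝ V).symm.continuous.measurable.comp (measurable_fderiv ℝ ψ)

variable {Y : Type*} [TopologicalSpace Y] [CompactSpace Y] [MeasurableSpace Y] [BorelSpace Y]
  {μ : Measure Y}

theorem integrable_smul_of_continuous {G : Type*} [NormedAddCommGroup G] [NormedSpace ℝ G]
    [SecondCountableTopology G]
    {ρ : Y → ℝ} (hρ : Integrable ρ μ) {f : Y → G} (hf : Continuous f) :
    Integrable (fun y => ρ y • f y) μ := by
  obtain ⟨S, hS⟩ := isCompact_univ.exists_bound_of_continuousOn hf.continuousOn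
  borelize G
  refine (hρ.norm.mul_const S).mono' (hρ.1.smul hf.measurable.aestronglyMeasurable)
    (Eventually.of_forall fun y => ?_)
  rw [norm_smul]
  gcongr
  exact hS y (mem_univ y)

variable {ψ : V → ℝ} {r : Y → V} {ρ : Y → ℝ} {δ C : ℝ}

/-- The average of the translated loss `ψ(r + t)`. -/
noncomputable def avgLoss (μ : Measure Y) (ψ : V → ℝ) (r : Y → V) (ρ : Y → ℝ) (t : V) : ℝ :=
  ∫ y, ψ (r y + t) * ρ y ∂μ

/-- The average of the gradient of the translated loss. -/
noncomputable def avgGrad (μ : Measure Y) (ψ : V → ℝ) (r : Y → V) (ρ : Y → ℝ) (t : V) : V :=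
  ∫ y, ρ y • gradient ψ (r y + t) ∂μ

theorem add_mem_ball_of_norm_lt {V : Type*} [NormedAddCommGroup V] {t : V} {δ : ℝ}
    (ht : ‖t‖ < δ) (y : V) :
    y + t ∈ Metric.ball y δ := by simpa using ht

theorem SmoothNear.continuous_gradient {Z : Type*} [TopologicalSpace Z] {r : Z → V} {δ C : ℝ}
    (h : SmoothNear ψ (range r) δ C)
    (hr : Continuous r) {t : V} (ht : ‖t‖ < δ) : Continuous fun y => gradient ψ (r y + t) := by
  rw [continuous_iff_continuousAt]
  intro y
  have h1 := h.continuousAt (mem_range_self y) (add_mem_ball_of_norm_lt ht (r y))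
  exact ContinuousAt.comp (f := fun y => r y + t) h1 (by fun_prop)

theorem SmoothNear.integrable_gradient (h : SmoothNear ψ (range r) δ C) (hr : Continuous r)
    (hρ : Integrable ρ μ) {t : V} (ht : ‖t‖ < δ) :
    Integrable (fun y => ρ y • gradient ψ (r y + t)) μ :=
  integrable_smul_of_continuous hρ (h.continuous_gradient hr ht)

/-- Differentiation under the integral. On each `δ`-ball the gradient is bounded by `S + C * δ`: `S`
bounds it at the centres since `Y` is compact, and the Lipschitz constant controls the rest. -/
theorem SmoothNear.hasGradientAt_avgLoss (h : SmoothNear ψ (range r) δ C) (hC : 0 ≤ C)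
    (hψ : Continuous ψ) (hr : Continuous r)
    (hρ : Integrable ρ μ) {t : V} (ht : ‖t‖ < δ) :
    HasGradientAt (avgLoss μ ψ r ρ) (avgGrad μ ψ r ρ t) t := by
  have hδ : 0 < δ := (norm_nonneg t).trans_lt ht
  obtain ⟨S, hS⟩ := isCompact_univ.exists_bound_of_continuousOn
    (h.continuous_gradient hr (t := 0) (by simpa using hδ)).continuousOn
  have hbd : ∀ y, ∀ x ∈ Metric.ball (r y) δ, ‖gradient ψ x‖ ≤ S + C * δ := by
    intro y x hx
    have h1 := (h (r y) (mem_range_self y)).2 x hx (r y) (Metric.mem_ball_self hδ)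
    have h2 := hS y (mem_univ y)
    rw [add_zero] at h2
    have h3 : ‖x - r y‖ ≤ δ := by rw [← dist_eq_norm]; exact (Metric.mem_ball.1 hx).le
    calc _ = ‖gradient ψ x - gradient ψ (r y) + gradient ψ (r y)‖ := by simp
      _ ≤ ‖gradient ψ x - gradient ψ (r y)‖ + ‖gradient ψ (r y)‖ := norm_add_le _ _
      _ ≤ _ := by nlinarith [mul_le_mul_of_nonneg_left h3 hC]
  have hint : ∀ x : V, Integrable (fun y => ψ (r y + x) * ρ y) μ := fun x => by
    have := integrable_smul_of_continuous hρ (f := fun y => ψ (r y + x)) (by fun_prop)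
    simpa [mul_comm] using this
  have hgi := h.integrable_gradient hr hρ ht
  have key := hasFDerivAt_integral_of_dominated_loc_of_lip' (μ := μ) (x₀ := t) (𝕜 := ℝ)
    (F := fun x y => ψ (r y + x) * ρ y)
    (F' := fun y => innerSL ℝ (ρ y • gradient ψ (r y + t)))
    (s := Metric.ball (0 : V) δ) (bound := fun y => (S + C * δ) * |ρ y|)
    (Metric.isOpen_ball.mem_nhds (by simpa using ht))
    (fun x _ => (hint x).1) (hint t)
    ((innerSL ℝ).continuous.comp_aestronglyMeasurable hgi.1) ?_ (hρ.norm.const_mul _) ?_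
  · rw [HasGradientAt]
    refine key.2.congr_fderiv ?_
    ext v
    rw [ContinuousLinearMap.integral_apply key.1]
    simp only [innerSL_apply_apply, InnerProductSpace.toDual_apply_apply, avgGrad]
    rw [real_inner_comm, ← integral_inner hgi]
    simp_rw [real_inner_comm]
  · refine Eventually.of_forall fun y x hx => ?_
    have hx' : r y + x ∈ Metric.ball (r y) δ := add_mem_ball_of_norm_lt (by simpa using hx) _
    have ht' : r y + t ∈ Metric.ball (r y) δ := add_mem_ball_of_norm_lt ht _
    have := (convex_ball (r y) δ).norm_image_sub_le_of_norm_fderiv_le (𝕜 := ℝ) (f := ψ)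
      (C := S + C * δ) (fun z hz => (h (r y) (mem_range_self y)).1 z hz)
      (fun z hz => by
        have e : ‖fderiv ℝ ψ z‖ = ‖gradient ψ z‖ := by simp [gradient]
        rw [e]; exact hbd y z hz) ht' hx'
    rw [← sub_mul, norm_mul]
    rw [add_sub_add_left_eq_sub] at this
    calc _ ≤ ((S + C * δ) * ‖x - t‖) * ‖ρ y‖ := by gcongr
      _ = _ := by rw [Real.norm_eq_abs]; ring
  · refine Eventually.of_forall fun y => ?_
    have h1 := ((h (r y) (mem_range_self y)).1 _ (add_mem_ball_of_norm_lt ht _)).hasGradientAt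
    have h2 : HasFDerivAt (fun x => r y + x) (ContinuousLinearMap.id ℝ V) t :=
      (hasFDerivAt_id t).const_add _
    have h3 := (h1.hasFDerivAt.comp t h2).mul_const (ρ y)
    refine h3.congr_fderiv ?_
    ext v
    simp

theorem SmoothNear.norm_avgGrad_sub_le (h : SmoothNear ψ (range r) δ C)
    (hr : Continuous r) (hρ : Integrable ρ μ) (hρ0 : ∀ y, 0 ≤ ρ y) (hρ1 : ∫ y, ρ y ∂μ = 1)
    {t t' : V} (ht : ‖t‖ < δ) (ht' : ‖t'‖ < δ) :
    ‖avgGrad μ ψ r ρ t - avgGrad μ ψ r ρ t'‖ ≤ C * ‖t - t'‖ := by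
  rw [avgGrad, avgGrad,
    ← integral_sub (h.integrable_gradient hr hρ ht) (h.integrable_gradient hr hρ ht')]
  have : ∫ y, ρ y * (C * ‖t - t'‖) ∂μ = C * ‖t - t'‖ := by
    rw [integral_mul_const, hρ1, one_mul]
  rw [← this]
  refine norm_integral_le_of_norm_le (hρ.mul_const _) (Eventually.of_forall fun y => ?_)
  rw [← smul_sub, norm_smul, Real.norm_of_nonneg (hρ0 y)]
  refine mul_le_mul_of_nonneg_left ?_ (hρ0 y)
  simpa using (h (r y) (mem_range_self y)).2 _ (add_mem_ball_of_norm_lt ht _) _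
    (add_mem_ball_of_norm_lt ht' _)

/-- The Lipschitz bound on the gradient supplies the domination, so a second derivative is needed
only at almost every residual of positive density. This admits losses with kinks in the gradient. -/
theorem SmoothNear.hasFDerivAt_avgGrad (h : SmoothNear ψ (range r) δ C) (hδ : 0 < δ)
    (hr : Continuous r) (hρ : Integrable ρ μ) (hρ0 : ∀ y, 0 ≤ ρ y)
    (hdiff : ∀ᵐ y ∂μ, 0 < ρ y → DifferentiableAt ℝ (gradient ψ) (r y)) :
    Integrable (fun y => ρ y • fderiv ℝ (gradient ψ) (r y)) μ ∧
    HasFDerivAt (avgGrad μ ψ r ρ) (∫ y, ρ y • fderiv ℝ (gradient ψ) (r y) ∂μ) 0 := by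
  borelize V
  have hmeas : AEStronglyMeasurable (fun y => fderiv ℝ (gradient ψ) (r y)) μ :=
    ((measurable_fderiv ℝ (gradient ψ)).comp hr.measurable).aestronglyMeasurable
  refine hasFDerivAt_integral_of_dominated_loc_of_lip' (μ := μ) (x₀ := (0 : V)) (𝕜 := ℝ)
    (F := fun x y => ρ y • gradient ψ (r y + x))
    (s := Metric.ball (0 : V) δ) (bound := fun y => ρ y * C)
    (Metric.isOpen_ball.mem_nhds (by simpa using hδ))
    (fun x hx => (h.integrable_gradient hr hρ (by simpa using hx)).1)
    (h.integrable_gradient hr hρ (by simpa using hδ))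
    (hρ.1.smul hmeas) ?_ (hρ.mul_const _) ?_
  · refine Eventually.of_forall fun y x hx => ?_
    rw [← smul_sub, norm_smul, Real.norm_of_nonneg (hρ0 y), mul_assoc]
    refine mul_le_mul_of_nonneg_left ?_ (hρ0 y)
    simpa using (h (r y) (mem_range_self y)).2 _ (add_mem_ball_of_norm_lt (by simpa using hx) _) _
      (add_mem_ball_of_norm_lt (t := 0) (by simpa using hδ) _)
  · filter_upwards [hdiff] with y hy
    -- Where the density vanishes the integrand is identically zero in the translation, so the loss
    -- need not be twice differentiable there.
    rcases (hρ0 y).eq_or_lt with h0 | h0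
    · simp only [← h0, zero_smul]
      exact hasFDerivAt_const _ _
    · have h2 : HasFDerivAt (fun x => r y + x) (ContinuousLinearMap.id ℝ V) 0 :=
        (hasFDerivAt_id _).const_add _
      have h1 : HasFDerivAt (gradient ψ) (fderiv ℝ (gradient ψ) (r y)) (r y + 0) := by
        rw [add_zero]; exact (hy h0).hasFDerivAt
      exact (h1.comp 0 h2).const_smul (ρ y)

theorem SmoothNear.avgGrad_eq_zero (h : SmoothNear ψ (range r) δ C) (hδ : 0 < δ) (hC : 0 ≤ C)
    (hψ : Continuous ψ) (hr : Continuous r) (hρ : Integrable ρ μ)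
    (hmin : IsMinOn (avgLoss μ ψ r ρ) univ 0) : avgGrad μ ψ r ρ 0 = 0 := by
  have h1 := h.hasGradientAt_avgLoss hC hψ hr hρ (t := 0) (by simpa using hδ)
  have h2 := IsLocalMin.hasFDerivAt_eq_zero (hmin.isLocalMin univ_mem) h1.hasFDerivAt
  simpa using h2

/-- The bound is quadratic because the averaged gradient vanishes at `0` and is `C`-Lipschitz. It
dominates the difference quotients of order two of the risk. -/
theorem SmoothNear.abs_avgLoss_sub_le (h : SmoothNear ψ (range r) δ C) (hC : 0 ≤ C)
    (hψ : Continuous ψ) (hr : Continuous r) (hρ : Integrable ρ μ) (hρ0 : ∀ y, 0 ≤ ρ y)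
    (hρ1 : ∫ y, ρ y ∂μ = 1) (hzero : avgGrad μ ψ r ρ 0 = 0) {t : V} (ht : ‖t‖ < δ) :
    |avgLoss μ ψ r ρ t - avgLoss μ ψ r ρ 0| ≤ C * ‖t‖ ^ 2 := by
  have hδ : 0 < δ := (norm_nonneg t).trans_lt ht
  have hball : ∀ x ∈ Metric.closedBall (0 : V) ‖t‖, ‖x‖ < δ := fun x hx => by
    rw [mem_closedBall_zero_iff] at hx; linarith
  have hg := fun x (hx : x ∈ Metric.closedBall (0 : V) ‖t‖) =>
    (h.hasGradientAt_avgLoss hC hψ hr hρ (hball x hx)).hasFDerivAt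
  have := (convex_closedBall (0 : V) ‖t‖).norm_image_sub_le_of_norm_hasFDerivWithin_le (𝕜 := ℝ)
    (C := C * ‖t‖) (fun x hx => (hg x hx).hasFDerivWithinAt)
    (fun x hx => by
      have h1 := h.norm_avgGrad_sub_le hr hρ hρ0 hρ1 (hball x hx) (t' := 0) (by simpa using hδ)
      rw [hzero, sub_zero, sub_zero] at h1
      rw [LinearIsometryEquiv.norm_map]
      refine h1.trans ?_
      gcongr
      simpa using hx)
    (x := 0) (y := t) (by simp) (by simp)
  rw [Real.norm_eq_abs, sub_zero] at this
  linarith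

theorem SmoothNear.isLittleO_avgLoss (h : SmoothNear ψ (range r) δ C) (hδ : 0 < δ) (hC : 0 ≤ C)
    (hψ : Continuous ψ) (hr : Continuous r) (hρ : Integrable ρ μ) (hρ0 : ∀ y, 0 ≤ ρ y)
    (hdiff : ∀ᵐ y ∂μ, 0 < ρ y → DifferentiableAt ℝ (gradient ψ) (r y))
    (hzero : avgGrad μ ψ r ρ 0 = 0) :
    (fun t => avgLoss μ ψ r ρ t - avgLoss μ ψ r ρ 0 -
      1 / 2 * inner ℝ ((∫ y, ρ y • fderiv ℝ (gradient ψ) (r y) ∂μ) t) t)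
      =o[𝓝 0] fun t => ‖t‖ ^ 2 := by
  have h1 : ∀ᶠ x in 𝓝 (0 : V), HasGradientAt (avgLoss μ ψ r ρ) (avgGrad μ ψ r ρ x) x := by
    filter_upwards [Metric.ball_mem_nhds (0 : V) hδ] with x hx
    exact h.hasGradientAt_avgLoss hC hψ hr hρ (by simpa using hx)
  have := isLittleO_taylor_two h1 (h.hasFDerivAt_avgGrad hδ hr hρ hρ0 hdiff).2
  simpa [hzero] using this

end Averages

/-! ### Measurability and disintegration -/

/-- Nonnegativity is asked only for almost every `a`, since `condDens` is constrained only on the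
support of the index. -/
theorem integral_withDensity_prod {α β G : Type*} [MeasurableSpace α] [MeasurableSpace β]
    [NormedAddCommGroup G] [NormedSpace ℝ G] {μ : Measure α} [SFinite μ] {ν : Measure β}
    [SFinite ν] {f : α → β → ℝ} (hf : Measurable (Function.uncurry f))
    (hf0 : ∀ᵐ a ∂μ, ∀ b, 0 ≤ f a b) {h : α × β → G}
    (hh : Integrable h ((μ.prod ν).withDensity fun w => ENNReal.ofReal (f w.1 w.2))) :
    Integrable (fun a => ∫ b, f a b • h (a, b) ∂ν) μ ∧
    ∫ w, h w ∂((μ.prod ν).withDensity fun w => ENNReal.ofReal (f w.1 w.2)) =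
      ∫ a, ∫ b, f a b • h (a, b) ∂ν ∂μ := by
  have hm : Measurable fun w : α × β => ENNReal.ofReal (f w.1 w.2) := hf.ennreal_ofReal
  have hae : (fun w : α × β => (ENNReal.ofReal (f w.1 w.2)).toReal • h w)
      =ᵐ[μ.prod ν] fun w => f w.1 w.2 • h w := by
    filter_upwards [Measure.quasiMeasurePreserving_fst.ae hf0] with w hw
    rw [ENNReal.toReal_ofReal (hw _)]
  have hint : Integrable (fun w : α × β => f w.1 w.2 • h w) (μ.prod ν) :=
    ((integrable_withDensity_iff_integrable_smul' hm
      (Eventually.of_forall fun _ => ENNReal.ofReal_lt_top)).1 hh).congr hae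
  refine ⟨hint.integral_prod_left, ?_⟩
  rw [integral_withDensity_eq_integral_toReal_smul hm
    (Eventually.of_forall fun _ => ENNReal.ofReal_lt_top), integral_congr_ae hae,
    integral_prod _ hint]

theorem map_withDensity_comp {α β : Type*} [MeasurableSpace α] [MeasurableSpace β]
    {μ : Measure α} {Φ : α → β} (hΦ : Measurable Φ) {k : β → ℝ≥0∞} (hk : Measurable k) :
    (μ.withDensity fun a => k (Φ a)).map Φ = (μ.map Φ).withDensity k := by
  ext s hs
  rw [Measure.map_apply hΦ hs, withDensity_apply _ (hΦ hs), withDensity_apply _ hs,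
    setLIntegral_map hs hk hΦ]

/-- Link functions, mean curve and conditional mean are controlled only on the closed support of the
index; this replaces them by Borel functions on the whole line. -/
theorem exists_measurable_eqOn {G : Type*} [NormedAddCommGroup G] [MeasurableSpace G]
    [BorelSpace G] {S : Set ℝ} (hS : IsClosed S) {g : ℝ → G} (hg : ContinuousOn g S) :
    ∃ g' : ℝ → G, Measurable g' ∧ EqOn g' g S := by
  classical
  exact ⟨S.piecewise g 0, hg.measurable_piecewise continuousOn_const hS.measurableSet,
    fun u hu => by simp [hu]⟩

theorem continuous_beta {q : ℕ} : Continuous (beta : E q → E (q + 1)) := by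
  refine (PiLp.continuous_toLp 2 _).comp (continuous_pi fun i => ?_)
  refine Fin.cases ?_ (fun j => ?_) i
  · simp only [Fin.cons_zero]; fun_prop
  · simp only [Fin.cons_succ]; fun_prop

theorem continuous_index {q : ℕ} : Continuous fun w : E q × E (q + 1) => index w.1 w.2 :=
  continuous_snd.inner (continuous_beta.comp continuous_fst)

theorem continuous_index_right {q : ℕ} (θ : E q) : Continuous (index θ : E (q + 1) → ℝ) :=
  continuous_id.inner continuous_const

theorem isOpen_param {q : ℕ} : IsOpen (Param q) :=
  isOpen_lt (by fun_prop) continuous_const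

instance {d : ℕ} : IsFiniteMeasure (surf d) := by unfold surf; infer_instance

/-! ### Standing assumptions, the support of the index, and conditioning on `X` or on `U_θ` -/

namespace Model

variable {q d : ℕ} {M : Model q d}

/-- The standing assumptions on the model. -/
structure Regular (M : Model q d) : Prop where
  prob : IsProbabilityMeasure M.law
  dens : M.IsCondDens
  link : M.IsLink
  smooth : M.SmoothLink
  param : M.IsTrueParam
  mean : M.IsCondMean
  conc : ∃ κ, M.InConcentrationClass κ
  a1 : M.A1
  a2 : M.A2
  a3 : M.A3
  a4 : M.A4

theorem measurable_index (θ : E q) :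
    Measurable fun z : E (q + 1) × Sph d => index θ z.1 :=
  (continuous_index_right θ).measurable.comp measurable_fst

theorem isClosed_indexSupp (θ : E q) : IsClosed (M.indexSupp θ) := Measure.isClosed_support

theorem ae_mem_indexSupp (θ : E q) : ∀ᵐ u ∂M.indexLaw θ, u ∈ M.indexSupp θ :=
  Measure.support_mem_ae

theorem ae_index_mem (θ : E q) : ∀ᵐ z ∂M.law, index θ z.1 ∈ M.indexSupp θ :=
  ae_of_ae_map (measurable_index θ).aemeasurable (ae_mem_indexSupp θ)

/-- The law of the predictors. -/
noncomputable def predLaw (M : Model q d) : Measure (E (q + 1)) := M.law.map Prod.fst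

theorem map_index_predLaw (θ : E q) : M.predLaw.map (index θ) = M.indexLaw θ := by
  rw [predLaw, Measure.map_map (continuous_index_right θ).measurable measurable_fst]
  rfl

theorem ae_predLaw_index_mem (θ : E q) : ∀ᵐ x ∂M.predLaw, index θ x ∈ M.indexSupp θ := by
  have := ae_mem_indexSupp (M := M) θ
  rw [← map_index_predLaw] at this
  exact ae_of_ae_map (continuous_index_right θ).measurable.aemeasurable this

namespace Regular

variable (h : M.Regular)

include h

theorem isProbabilityMeasure_predLaw : IsProbabilityMeasure M.predLaw :=
  have := h.prob
  Measure.isProbabilityMeasure_map measurable_fst.aemeasurable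

theorem isProbabilityMeasure_indexLaw (θ : E q) : IsProbabilityMeasure (M.indexLaw θ) :=
  have := h.prob
  Measure.isProbabilityMeasure_map (measurable_index θ).aemeasurable

theorem ae_mem_predictors : ∀ᵐ x ∂M.predLaw, x ∈ M.predictors :=
  (ae_map_iff measurable_fst.aemeasurable h.a1.1.isClosed.measurableSet).2 h.a1.2.1

/-- The image is compact, hence closed, and carries the law of `U_θ`. So each point of the support
is the index of an actual predictor, and the support is compact. -/
theorem indexSupp_subset (θ : E q) : M.indexSupp θ ⊆ index θ '' M.predictors := by
  have hcl : IsClosed (index θ '' M.predictors) := (h.a1.1.image (continuous_index_right θ)).isClosed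
  refine Measure.support_subset_of_isClosed hcl ?_
  change ∀ᵐ u ∂M.indexLaw θ, u ∈ index θ '' M.predictors
  refine (ae_map_iff (p := fun u => u ∈ index θ '' M.predictors)
    (measurable_index θ).aemeasurable hcl.measurableSet).2 ?_
  filter_upwards [h.a1.2.1] with z hz using mem_image_of_mem _ hz

theorem isCompact_indexSupp (θ : E q) : IsCompact (M.indexSupp θ) := by
  exact (h.a1.1.image (continuous_index_right θ)).of_isClosed_subset (isClosed_indexSupp θ) (h.indexSupp_subset θ)

/-- The law of `U_θ` has a density, hence no atoms, so a point of its support cannot be isolated in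
the support. This gives `derivWithin` in `linkDeriv` its meaning. -/
theorem uniqueDiffWithinAt {θ : E q} (hθ : θ ∈ Param q) {u : ℝ} (hu : u ∈ M.indexSupp θ) :
    UniqueDiffWithinAt ℝ (M.indexSupp θ) u := by
  rw [uniqueDiffWithinAt_iff_accPt, accPt_iff_nhds]
  intro U hU
  by_contra hcon
  push Not at hcon
  have h1 : 0 < M.indexLaw θ U := Measure.mem_support_iff_forall u |>.1 hu U hU
  have h2 : M.indexLaw θ {u} = 0 := by
    obtain ⟨g, hg, -⟩ := (h.a1.2.2 θ hθ).2
    rw [hg]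
    refine withDensity_absolutelyContinuous _ _ ?_
    exact Measure.absolutelyContinuous_of_le Measure.restrict_le_self (measure_singleton u)
  have h3 : M.indexLaw θ U = 0 := by
    refine measure_mono_null_ae ?_ h2
    filter_upwards [ae_mem_indexSupp (M := M) θ] with v hv hvU
    exact hcon v ⟨hvU, hv⟩
  exact h1.ne' h3

theorem continuousOn_link {θ : E q} (hθ : θ ∈ Param q) :
    ContinuousOn (M.link θ) (M.indexSupp θ) :=
  h.smooth.continuousOn.comp (f := fun u : ℝ => (θ, u)) (by fun_prop) fun _ hu => ⟨hθ, hu⟩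

theorem index_mem {θ : E q} (hθ : θ ∈ Param q) {x : E (q + 1)} (hx : x ∈ M.predictors) :
    index θ x ∈ M.indexSupp θ := (h.a1.2.2 θ hθ).1 x hx

theorem continuousOn_link_index :
    ContinuousOn (fun w : E q × E (q + 1) => M.link w.1 (index w.1 w.2))
      (Param q ×ˢ M.predictors) :=
  h.smooth.continuousOn.comp
    (f := fun w : E q × E (q + 1) => (w.1, index w.1 w.2))
    (continuous_fst.prodMk continuous_index).continuousOn
    fun _ hw => ⟨hw.1, h.index_mem hw.1 hw.2⟩

theorem integrable_condDens {θ : E q} (hθ : θ ∈ Param q) {u : ℝ} (hu : u ∈ M.indexSupp θ) :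
    Integrable (M.condDens θ u) (surf d) := by
  by_contra hcon
  have := ((h.dens θ hθ).2.1 u hu).2
  rw [integral_undef hcon] at this
  exact zero_ne_one this

theorem param_mem : M.trueParam ∈ Param q := h.param.1

/-- Given the predictors, `Y` has the conditional density given the index at the true
parameter. -/
theorem law_eq : M.law = (M.predLaw.prod (surf d)).withDensity fun z =>
    ENNReal.ofReal (M.condDens M.trueParam (index M.trueParam z.1) z.2) := by
  have := h.isProbabilityMeasure_predLaw
  have := h.isProbabilityMeasure_indexLaw M.trueParam
  obtain ⟨κ, hne, f, c, hf, -, -, hlaw⟩ := h.conc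
  have hcurve : ContinuousOn M.meanCurve (M.indexSupp M.trueParam) := by
    have := h.continuousOn_link h.param_mem
    exact (this.norm.inv₀ fun u hu => norm_ne_zero_iff.2 (hne u hu)).smul this
  obtain ⟨m, hm, hmeq⟩ := exists_measurable_eqOn (isClosed_indexSupp _) hcurve
  -- The density of the concentration class is a function of `(u, y)` only, with `m` a Borel version
  -- of the mean curve.
  let k : ℝ × Sph d → ℝ≥0∞ := fun w =>
    ENNReal.ofReal (c * f (κ * inner ℝ (w.2 : E d) (m w.1)))
  have hk : Measurable k := by
    refine Measurable.ennreal_ofReal (measurable_const.mul (hf.comp (measurable_const.mul ?_)))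
    exact (measurable_subtype_coe.comp measurable_snd).inner (hm.comp measurable_fst)
  let Φ : E (q + 1) × Sph d → ℝ × Sph d := Prod.map (index M.trueParam) id
  have hΦ : Measurable Φ := (continuous_index_right _).measurable.prodMap measurable_id
  have hlaw' : M.law = (M.predLaw.prod (surf d)).withDensity fun z => k (Φ z) := by
    rw [hlaw]
    refine withDensity_congr_ae ?_
    filter_upwards [Measure.quasiMeasurePreserving_fst.ae
      (ae_predLaw_index_mem (M := M) M.trueParam)] with z hz
    simp only [k, Φ, Prod.map, hmeq hz, id]
  have hmapΦ : (M.predLaw.prod (surf d)).map Φ = (M.indexLaw M.trueParam).prod (surf d) := by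
    rw [← map_index_predLaw, ← Measure.map_prod_map _ _ (continuous_index_right _).measurable measurable_id,
      Measure.map_id]
  have h1 : M.law.map Φ = ((M.indexLaw M.trueParam).prod (surf d)).withDensity k := by
    rw [hlaw', map_withDensity_comp hΦ hk, hmapΦ]
  have h2 := (h.dens M.trueParam h.param_mem).2.2
  have h3 : Measurable fun w : ℝ × Sph d =>
      ENNReal.ofReal (M.condDens M.trueParam w.1 w.2) :=
    (h.dens M.trueParam h.param_mem).1.ennreal_ofReal
  -- The law of `(U, Y)` now has two densities with respect to the same product measure; they agree
  -- almost everywhere, and the agreement pulls back along `Φ`.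
  have h4 : k =ᵐ[(M.indexLaw M.trueParam).prod (surf d)]
      fun w => ENNReal.ofReal (M.condDens M.trueParam w.1 w.2) := by
    rw [← withDensity_eq_iff_of_sigmaFinite hk.aemeasurable h3.aemeasurable, ← h1, ← h2]
    rfl
  rw [← hmapΦ] at h4
  conv_lhs => rw [hlaw']
  exact withDensity_congr_ae (ae_of_ae_map hΦ.aemeasurable h4)

/-- Conditioning on `X`: the density is the one at `θ₀` whatever the integrand, in contrast to
`integral_index`, which conditions on `U_θ` and uses the density at `θ`. -/
theorem integral_law {G : Type*} [NormedAddCommGroup G] [NormedSpace ℝ G]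
    {g : E (q + 1) × Sph d → G} (hg : Integrable g M.law) :
    Integrable (fun x => ∫ y, M.condDens M.trueParam (index M.trueParam x) y • g (x, y)
      ∂(surf d)) M.predLaw ∧
    ∫ z, g z ∂M.law = ∫ x, ∫ y, M.condDens M.trueParam (index M.trueParam x) y • g (x, y)
      ∂(surf d) ∂M.predLaw := by
  have := h.isProbabilityMeasure_predLaw
  have hm : Measurable (Function.uncurry fun (x : E (q + 1)) (y : Sph d) =>
      M.condDens M.trueParam (index M.trueParam x) y) :=
    (h.dens M.trueParam h.param_mem).1.comp ((continuous_index_right _).measurable.prodMap measurable_id)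
  have h0 : ∀ᵐ x ∂M.predLaw, ∀ y, 0 ≤ M.condDens M.trueParam (index M.trueParam x) y := by
    filter_upwards [ae_predLaw_index_mem (M := M) M.trueParam] with x hx
    exact ((h.dens M.trueParam h.param_mem).2.1 _ hx).1
  have hlaw := h.law_eq
  have hg' := hg
  rw [hlaw] at hg'
  have := integral_withDensity_prod hm h0 hg'
  rwa [← hlaw] at this

theorem integral_index {θ : E q} (hθ : θ ∈ Param q) {G : Type*} [NormedAddCommGroup G]
    [NormedSpace ℝ G] {g : ℝ × Sph d → G}
    (hg : Integrable g (M.law.map fun z => (index θ z.1, z.2))) :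
    ∫ w, g w ∂(M.law.map fun z => (index θ z.1, z.2)) =
      ∫ u, ∫ y, M.condDens θ u y • g (u, y) ∂(surf d) ∂M.indexLaw θ := by
  have := h.isProbabilityMeasure_indexLaw θ
  have h0 : ∀ᵐ u ∂M.indexLaw θ, ∀ y, 0 ≤ M.condDens θ u y := by
    filter_upwards [ae_mem_indexSupp (M := M) θ] with u hu
    exact ((h.dens θ hθ).2.1 _ hu).1
  have hlaw := (h.dens θ hθ).2.2
  rw [hlaw] at hg ⊢
  exact (integral_withDensity_prod (h.dens θ hθ).1 h0 hg).2

end Regular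

end Model

/-! ### Derivatives of the link function along the parametrization -/

/-- The continuous linear map between Euclidean spaces given by a matrix. -/
noncomputable def matrixMap {m n : ℕ} (A : Matrix (Fin m) (Fin n) ℝ) : E n →L[ℝ] E m :=
  LinearMap.toContinuousLinearMap (Matrix.toEuclideanLin A)

theorem matrixMap_apply {m n : ℕ} (A : Matrix (Fin m) (Fin n) ℝ) (v : E n) :
    matrixMap A v = WithLp.toLp 2 (A *ᵥ v.ofLp) := rfl

theorem hasFDerivAt_beta {q : ℕ} {θ : E q} (hθ : θ ∈ Param q) :
    HasFDerivAt (beta : E q → E (q + 1)) (matrixMap (jac θ)) θ := by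
  have hθ' : (1 : ℝ) - ‖θ‖ ^ 2 ≠ 0 := (sub_pos.2 hθ).ne'
  rw [← hasFDerivWithinAt_univ, hasFDerivWithinAt_euclidean]
  intro i
  rw [hasFDerivWithinAt_univ]
  refine Fin.cases ?_ (fun j => ?_) i
  · have h1 : HasFDerivAt (fun θ : E q => Real.sqrt (1 - ‖θ‖ ^ 2)) _ θ :=
      ((hasStrictFDerivAt_norm_sq θ).hasFDerivAt.const_sub 1).sqrt hθ'
    refine h1.congr_fderiv ?_
    ext η
    have hs : Real.sqrt (1 - ‖θ‖ ^ 2) ≠ 0 := (Real.sqrt_pos.2 (sub_pos.2 hθ)).ne'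
    simp only [matrixMap_apply, jac, ContinuousLinearMap.coe_comp, Function.comp_apply,
      PiLp.proj_apply, Matrix.mulVec, dotProduct, Matrix.of_apply, Fin.cons_zero,
      smul_apply, neg_apply, innerSL_apply_apply,
      PiLp.inner_apply, smul_eq_mul, nsmul_eq_mul]
    simp only [RCLike.inner_apply, conj_trivial, mul_neg, Finset.mul_sum, ← Finset.sum_neg_distrib]
    refine Finset.sum_congr rfl fun k _ => ?_
    push_cast
    field_simp
  · have h1 : HasFDerivAt (fun θ : E q => θ j) (PiLp.proj 2 (fun _ => ℝ) j : E q →L[ℝ] ℝ) θ :=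
      (PiLp.proj 2 (fun _ : Fin q => ℝ) j : E q →L[ℝ] ℝ).hasFDerivAt
    refine h1.congr_fderiv ?_
    ext η
    simp [matrixMap_apply, jac, Matrix.mulVec, dotProduct]

/-- The derivative of `θ ↦ xᵀ β(θ)`. -/
noncomputable def indexDeriv {q : ℕ} (θ : E q) (x : E (q + 1)) : E q →L[ℝ] ℝ :=
  (innerSL ℝ x).comp (matrixMap (jac θ))

theorem hasFDerivAt_index {q : ℕ} {θ : E q} (hθ : θ ∈ Param q) (x : E (q + 1)) :
    HasFDerivAt (fun θ => index θ x) (indexDeriv θ x) θ :=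
  (innerSL ℝ x).hasFDerivAt.comp θ (hasFDerivAt_beta hθ)

namespace Model

variable {q d : ℕ} {M : Model q d}

/-- The derivative of `θ ↦ μ_θ(xᵀβ(θ))` at the true parameter. -/
noncomputable def pathDeriv (M : Model q d) (x : E (q + 1)) : E q →L[ℝ] E d :=
  fderiv ℝ (fun θ => M.link θ (index θ x)) M.trueParam

/-- The partial derivative of `μ_θ(u)` in `θ` at the true parameter. -/
noncomputable def linkParamDeriv (M : Model q d) (u : ℝ) : E q →L[ℝ] E d :=
  (fderivWithin ℝ (Function.uncurry M.link) M.domain (M.trueParam, u)).comp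
    (ContinuousLinearMap.inl ℝ (E q) ℝ)

namespace Regular

variable (h : M.Regular)

include h

/-- For fixed `x ∈ 𝒳` the path `θ ↦ (θ, xᵀβ(θ))` never leaves `M.domain`, by (A1), so a derivative
within the domain yields an ordinary derivative on the open set `Θ`. -/
theorem hasFDerivAt_path_of_hasFDerivWithinAt {x : E (q + 1)} (hx : x ∈ M.predictors)
    {L : E q × ℝ →L[ℝ] E d} (hL : HasFDerivWithinAt (Function.uncurry M.link) L M.domain
      (M.trueParam, index M.trueParam x)) :
    HasFDerivAt (fun θ => M.link θ (index θ x))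
      (L.comp ((ContinuousLinearMap.id ℝ (E q)).prod (indexDeriv M.trueParam x)))
      M.trueParam := by
  have h1 : HasFDerivWithinAt (fun θ : E q => (θ, index θ x))
      ((ContinuousLinearMap.id ℝ (E q)).prod (indexDeriv M.trueParam x)) (Param q)
      M.trueParam :=
    ((hasFDerivAt_id _).prodMk (hasFDerivAt_index h.param_mem x)).hasFDerivWithinAt
  have hmaps : MapsTo (fun θ : E q => (θ, index θ x)) (Param q) M.domain :=
    fun θ hθ => ⟨hθ, h.index_mem hθ hx⟩
  have h2 := HasFDerivWithinAt.comp M.trueParam hL h1 hmaps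
  exact h2.hasFDerivAt (isOpen_param.mem_nhds h.param_mem)

theorem hasFDerivAt_path {x : E (q + 1)} (hx : x ∈ M.predictors) :
    HasFDerivAt (fun θ => M.link θ (index θ x)) (M.pathDeriv x) M.trueParam := by
  have h1 := (h.smooth.differentiableOn one_ne_zero) (M.trueParam, index M.trueParam x)
    ⟨h.param_mem, h.index_mem h.param_mem hx⟩
  exact (h.hasFDerivAt_path_of_hasFDerivWithinAt hx
    h1.hasFDerivWithinAt).differentiableAt.hasFDerivAt

theorem apply_eq_linkDeriv {u : ℝ} (hu : u ∈ M.indexSupp M.trueParam)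
    {L : E q × ℝ →L[ℝ] E d} (hL : HasFDerivWithinAt (Function.uncurry M.link) L M.domain
      (M.trueParam, u)) : L (0, 1) = M.linkDeriv M.trueParam u := by
  have h1 : HasDerivWithinAt (fun u : ℝ => (M.trueParam, u)) ((0 : E q), (1 : ℝ))
      (M.indexSupp M.trueParam) u :=
    ((hasDerivAt_const u M.trueParam).prodMk (hasDerivAt_id u)).hasDerivWithinAt
  have h2 := hL.comp_hasDerivWithinAt u h1 (fun v hv => ⟨h.param_mem, hv⟩)
  exact (h2.derivWithin (h.uniqueDiffWithinAt h.param_mem hu)).symm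

/-- Derivatives within `M.domain` are not known to be unique a priori. Moving `u` inside the support
fixes `L` on `(0, 1)`, moving `θ` along the path through `x` fixes `L (η, xᵀJη)`, and the difference
gives `L (η, 0)`. -/
theorem apply_eq_pathDeriv {x : E (q + 1)} (hx : x ∈ M.predictors)
    {L : E q × ℝ →L[ℝ] E d} (hL : HasFDerivWithinAt (Function.uncurry M.link) L M.domain
      (M.trueParam, index M.trueParam x)) (η : E q) :
    L (η, 0) = M.pathDeriv x η - indexDeriv M.trueParam x η •
      M.linkDeriv M.trueParam (index M.trueParam x) := by
  rw [← h.apply_eq_linkDeriv (h.index_mem h.param_mem hx) hL,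
    (h.hasFDerivAt_path hx).unique (h.hasFDerivAt_path_of_hasFDerivWithinAt hx hL),
    ← map_smul, ContinuousLinearMap.comp_apply, ← map_sub]
  simp

theorem pathDeriv_apply {x : E (q + 1)} (hx : x ∈ M.predictors) (η : E q) :
    M.pathDeriv x η = M.linkParamDeriv (index M.trueParam x) η +
      indexDeriv M.trueParam x η • M.linkDeriv M.trueParam (index M.trueParam x) := by
  have h1 := ((h.smooth.differentiableOn one_ne_zero) (M.trueParam, index M.trueParam x)
    ⟨h.param_mem, h.index_mem h.param_mem hx⟩).hasFDerivWithinAt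
  have := h.apply_eq_pathDeriv hx h1 η
  simp only [linkParamDeriv, ContinuousLinearMap.comp_apply, ContinuousLinearMap.inl_apply]
  rw [this, sub_add_cancel]

/-- Continuous differentiability provides locally some continuous family of derivatives within the
domain. If all such derivatives agree at `w`, their common value inherits the continuity. -/
theorem continuousOn_linkDeriv_aux (w : E q × ℝ) {g : ℝ → E d}
    (hg : ∀ u ∈ M.indexSupp M.trueParam, ∀ L : E q × ℝ →L[ℝ] E d,
      HasFDerivWithinAt (Function.uncurry M.link) L M.domain (M.trueParam, u) → L w = g u) :
    ContinuousOn g (M.indexSupp M.trueParam) := by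
  intro u hu
  have hmem : (M.trueParam, u) ∈ M.domain := ⟨h.param_mem, hu⟩
  have h1 : ContDiffWithinAt ℝ (0 + 1) (Function.uncurry M.link) M.domain (M.trueParam, u) := by
    rw [zero_add]; exact h.smooth _ hmem
  obtain ⟨U, hU, -, -, f', hf', hc⟩ :=
    (contDiffWithinAt_succ_iff_hasFDerivWithinAt' (by simp)).1 h1
  rw [insert_eq_of_mem hmem] at hU
  have h2 : Tendsto (fun v : ℝ => (M.trueParam, v)) (𝓝[M.indexSupp M.trueParam] u)
      (𝓝[M.domain] (M.trueParam, u)) := by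
    refine tendsto_nhdsWithin_of_tendsto_nhds_of_eventually_within _ ?_ ?_
    · exact ((by fun_prop : Continuous fun v : ℝ => (M.trueParam, v)).tendsto u).mono_left
        nhdsWithin_le_nhds
    · exact eventually_mem_of_tendsto_nhdsWithin (f := id) tendsto_id |>.mono
        fun v hv => ⟨h.param_mem, hv⟩
  have h3 : Tendsto (fun v : ℝ => f' (M.trueParam, v) w) (𝓝[M.indexSupp M.trueParam] u)
      (𝓝 (f' (M.trueParam, u) w)) :=
    (((ContinuousLinearMap.apply ℝ (E d) w).continuous.tendsto _).comp
      hc.continuousWithinAt.tendsto).comp h2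
  have h4 : ∀ᶠ v in 𝓝[M.indexSupp M.trueParam] u, f' (M.trueParam, v) w = g v := by
    filter_upwards [h2 hU, self_mem_nhdsWithin] with v hv hvs
    exact hg v hvs _ (hf' _ hv)
  rw [ContinuousWithinAt, ← hg u hu _ (hf' _ (mem_of_mem_nhdsWithin hmem hU))]
  exact h3.congr' h4

theorem continuousOn_linkDeriv :
    ContinuousOn (M.linkDeriv M.trueParam) (M.indexSupp M.trueParam) :=
  h.continuousOn_linkDeriv_aux (0, 1) fun _ hu _ hL => h.apply_eq_linkDeriv hu hL

theorem continuousOn_linkParamDeriv (η : E q) :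
    ContinuousOn (fun u => M.linkParamDeriv u η) (M.indexSupp M.trueParam) := by
  refine h.continuousOn_linkDeriv_aux (η, 0) fun u hu L hL => ?_
  -- A predictor with index `u` is needed, since `L (η, 0)` is read off along its path.
  obtain ⟨x, hx, rfl⟩ := h.indexSupp_subset M.trueParam hu
  rw [h.apply_eq_pathDeriv hx hL, h.pathDeriv_apply hx, add_sub_cancel_right]

end Regular

end Model

namespace Model

variable {q d : ℕ} {M : Model q d}

/-! ### The conditional risk -/

/-- The conditional mean of the Hessian of the loss given the index, at the true parameter. -/
noncomputable def hessMap (M : Model q d) (u : ℝ) : E d →L[ℝ] E d :=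
  matrixMap (M.F M.trueParam u)

/-- The conditional mean of the gradient of the loss at a residual translated by `t`. -/
noncomputable def meanGrad (M : Model q d) (u : ℝ) (t : E d) : E d :=
  avgGrad (surf d) M.loss (M.resid M.trueParam u) (M.condDens M.trueParam u) t

/-- The deviation of the link function at `θ` from the one at the true parameter. -/
noncomputable def shift (M : Model q d) (θ : E q) (x : E (q + 1)) : E d :=
  M.link M.trueParam (index M.trueParam x) - M.link θ (index θ x)

/-- The set of residuals at the parameter `θ`. -/
def residuals (M : Model q d) (θ : E q) : Set (E d) :=
  (fun w : ℝ × Sph d => M.resid θ w.1 w.2) '' (M.indexSupp θ ×ˢ univ)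

theorem continuous_resid (θ : E q) (u : ℝ) : Continuous (M.resid θ u) :=
  continuous_subtype_val.sub continuous_const

theorem range_resid_subset {θ : E q} {u : ℝ} (hu : u ∈ M.indexSupp θ) :
    range (M.resid θ u) ⊆ M.residuals θ := by
  rintro _ ⟨y, rfl⟩
  exact ⟨(u, y), ⟨hu, mem_univ y⟩, rfl⟩

/-- This reduces risks and scores at any `θ` to translated averages at `θ₀`. -/
theorem resid_eq_add_shift (θ : E q) (x : E (q + 1)) (y : Sph d) :
    M.resid θ (index θ x) y =
      M.resid M.trueParam (index M.trueParam x) y + M.shift θ x := by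
  simp only [resid, shift]; abel

theorem shift_trueParam (x : E (q + 1)) : M.shift M.trueParam x = 0 := sub_self _

theorem ae_map_index_mem (θ : E q) :
    ∀ᵐ w ∂M.law.map (fun z => (index θ z.1, z.2)), w.1 ∈ M.indexSupp θ := by
  have hm : Measurable fun z : E (q + 1) × Sph d => (index θ z.1, z.2) :=
    (measurable_index θ).prodMk measurable_snd
  refine (ae_map_iff (p := fun w : ℝ × Sph d => w.1 ∈ M.indexSupp θ) hm.aemeasurable
    (measurable_fst (isClosed_indexSupp θ).measurableSet)).2 (ae_index_mem θ)

namespace Regular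

variable (h : M.Regular)

include h

theorem continuousOn_resid {θ : E q} (hθ : θ ∈ Param q) :
    ContinuousOn (fun w : ℝ × Sph d => M.resid θ w.1 w.2) (M.indexSupp θ ×ˢ univ) :=
  (continuous_subtype_val.comp continuous_snd).continuousOn.sub
    ((h.continuousOn_link hθ).comp continuous_fst.continuousOn fun _ hw => hw.1)

theorem isCompact_residuals {θ : E q} (hθ : θ ∈ Param q) : IsCompact (M.residuals θ) :=
  ((h.isCompact_indexSupp θ).prod isCompact_univ).image_of_continuousOn (h.continuousOn_resid hθ)

theorem exists_smoothNear_residuals {θ : E q} (hθ : θ ∈ Param q) :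
    ∃ δ > 0, ∃ C, 0 ≤ C ∧ SmoothNear M.loss (M.residuals θ) δ C := by
  refine exists_smoothNear (h.isCompact_residuals hθ) ?_
  rintro _ ⟨⟨u, y⟩, ⟨hu, -⟩, rfl⟩
  exact (h.a3.2.1 θ hθ u hu).1 y

theorem continuous_loss : Continuous M.loss := h.a3.1

theorem continuousOn_gradient {θ : E q} (hθ : θ ∈ Param q) :
    ContinuousOn (gradient M.loss) (M.residuals θ) := by
  obtain ⟨δ, hδ, C, -, hs⟩ := h.exists_smoothNear_residuals hθ
  exact fun r hr => (hs.continuousAt hr (Metric.mem_ball_self hδ)).continuousWithinAt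

theorem condDens_nonneg {θ : E q} (hθ : θ ∈ Param q) {u : ℝ} (hu : u ∈ M.indexSupp θ)
    (y : Sph d) : 0 ≤ M.condDens θ u y := ((h.dens θ hθ).2.1 u hu).1 y

theorem integral_condDens {θ : E q} (hθ : θ ∈ Param q) {u : ℝ} (hu : u ∈ M.indexSupp θ) :
    ∫ y, M.condDens θ u y ∂(surf d) = 1 := ((h.dens θ hθ).2.1 u hu).2

/-- First-order condition for the link: the substitution `m = μ_θ(u) - t` moves the minimum to `t =
0`. -/
theorem avgGrad_eq_zero {θ : E q} (hθ : θ ∈ Param q) {u : ℝ} (hu : u ∈ M.indexSupp θ) :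
    avgGrad (surf d) M.loss (M.resid θ u) (M.condDens θ u) 0 = 0 := by
  obtain ⟨δ, hδ, C, hC, hs⟩ := h.exists_smoothNear_residuals hθ
  refine (hs.mono (range_resid_subset hu)).avgGrad_eq_zero hδ hC h.continuous_loss
    (continuous_resid θ u) (h.integrable_condDens hθ hu) fun t _ => ?_
  have h1 := h.link θ hθ u hu (mem_univ (M.link θ u - t))
  simp only [condExpY, mem_ofPred_eq] at h1
  simp only [avgLoss, resid, add_zero, mem_ofPred_eq]
  have h2 : ∀ y : Sph d, (y : E d) - M.link θ u + t = (y : E d) - (M.link θ u - t) :=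
    fun y => by abel
  simp only [h2]
  exact h1

theorem measurable_resid_index {θ : E q} (hθ : θ ∈ Param q) :
    ∃ m : ℝ × Sph d → E d, Measurable m ∧
      ∀ w : ℝ × Sph d, w.1 ∈ M.indexSupp θ → m w = M.resid θ w.1 w.2 := by
  obtain ⟨m, hm, hmeq⟩ := exists_measurable_eqOn (isClosed_indexSupp θ) (h.continuousOn_link hθ)
  refine ⟨fun w => (w.2 : E d) - m w.1,
    (measurable_subtype_coe.comp measurable_snd).sub (hm.comp measurable_fst), fun w hw => ?_⟩
  simp only [hmeq hw, resid]

theorem aestronglyMeasurable_score {θ : E q} (hθ : θ ∈ Param q) {φ : ℝ → ℝ}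
    (hφ : Continuous φ) :
    AEStronglyMeasurable (fun w : ℝ × Sph d => φ w.1 • gradient M.loss (M.resid θ w.1 w.2))
      (M.law.map fun z => (index θ z.1, z.2)) := by
  obtain ⟨m, hm, hmeq⟩ := h.measurable_resid_index hθ
  have h1 : Measurable fun w : ℝ × Sph d => φ w.1 • gradient M.loss (m w) :=
    (hφ.measurable.comp measurable_fst).smul ((measurable_gradient M.loss).comp hm)
  refine h1.aestronglyMeasurable.congr ?_
  filter_upwards [ae_map_index_mem θ] with w hw
  rw [hmeq w hw]

/-- The estimating equation, multiplied by a function of the index. -/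
theorem integral_score_eq_zero {θ : E q} (hθ : θ ∈ Param q) {φ : ℝ → ℝ} (hφ : Continuous φ) :
    ∫ z, φ (index θ z.1) • gradient M.loss (M.resid θ (index θ z.1) z.2) ∂M.law = 0 := by
  have hm : Measurable fun z : E (q + 1) × Sph d => (index θ z.1, z.2) :=
    (measurable_index θ).prodMk measurable_snd
  have hae := h.aestronglyMeasurable_score hθ hφ
  have h1 := integral_map hm.aemeasurable hae
  rw [← h1]
  by_cases hint : Integrable (fun w : ℝ × Sph d =>
      φ w.1 • gradient M.loss (M.resid θ w.1 w.2)) (M.law.map fun z => (index θ z.1, z.2))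
  · rw [h.integral_index hθ hint]
    refine integral_eq_zero_of_ae ?_
    filter_upwards [ae_mem_indexSupp (M := M) θ] with u hu
    have h2 := h.avgGrad_eq_zero hθ hu
    simp only [avgGrad, add_zero] at h2
    simp only [smul_comm (M.condDens θ u _) (φ u), integral_smul, h2, smul_zero, Pi.zero_apply]
  -- Here the integral is zero by default; `integrable_score` shows that this case does not occur.
  · exact integral_undef hint

theorem integrable_score {θ : E q} (hθ : θ ∈ Param q) {φ : ℝ → ℝ} (hφ : Continuous φ) :
    Integrable (fun z => φ (index θ z.1) • gradient M.loss (M.resid θ (index θ z.1) z.2))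
      M.law := by
  have := h.prob
  have hm : Measurable fun z : E (q + 1) × Sph d => (index θ z.1, z.2) :=
    (measurable_index θ).prodMk measurable_snd
  have h1 := (h.aestronglyMeasurable_score hθ hφ).comp_measurable hm
  obtain ⟨A, hA⟩ := (h.isCompact_indexSupp θ).exists_bound_of_continuousOn hφ.continuousOn
  obtain ⟨B, hB⟩ := (h.isCompact_residuals hθ).exists_bound_of_continuousOn
    (h.continuousOn_gradient hθ)
  refine Integrable.of_bound h1 (A * B) ?_
  filter_upwards [ae_index_mem (M := M) θ] with z hz
  simp only [norm_smul]
  have h2 := hA _ hz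
  exact mul_le_mul h2 (hB _ (range_resid_subset hz (mem_range_self _))) (norm_nonneg _)
    ((norm_nonneg _).trans h2)

/-- The estimating equation at `θ`, averaged over `Y` at fixed `x`. Now `θ` enters only through the
weight and the shift, no longer through a density, so the equation can be differentiated at `θ₀`. -/
theorem integral_meanGrad_shift {θ : E q} (hθ : θ ∈ Param q) {φ : ℝ → ℝ} (hφ : Continuous φ) :
    Integrable (fun x => φ (index θ x) • M.meanGrad (index M.trueParam x) (M.shift θ x))
      M.predLaw ∧
    ∫ x, φ (index θ x) • M.meanGrad (index M.trueParam x) (M.shift θ x) ∂M.predLaw = 0 := by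
  have h1 := h.integral_law (h.integrable_score hθ hφ)
  rw [h.integral_score_eq_zero hθ hφ] at h1
  have h2 : ∀ x, ∫ y, M.condDens M.trueParam (index M.trueParam x) y • φ (index θ x) •
      gradient M.loss (M.resid θ (index θ x) y) ∂(surf d) =
      φ (index θ x) • M.meanGrad (index M.trueParam x) (M.shift θ x) := by
    intro x
    simp only [smul_comm _ (φ (index θ x)), integral_smul, meanGrad, avgGrad, resid_eq_add_shift θ x]
  simp only [h2] at h1
  exact ⟨h1.1, h1.2.symm⟩

theorem ae_differentiableAt_gradient {u : ℝ} (hu : u ∈ M.indexSupp M.trueParam) :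
    ∀ᵐ y ∂(surf d), 0 < M.condDens M.trueParam u y →
      DifferentiableAt ℝ (gradient M.loss) (M.resid M.trueParam u y) :=
  (h.a3.2.1 M.trueParam h.param_mem u hu).2

theorem integrable_fderiv_gradient {u : ℝ} (hu : u ∈ M.indexSupp M.trueParam) :
    Integrable (fun y => M.condDens M.trueParam u y •
      fderiv ℝ (gradient M.loss) (M.resid M.trueParam u y)) (surf d) := by
  obtain ⟨δ, hδ, C, hC, hs⟩ := h.exists_smoothNear_residuals h.param_mem
  exact ((hs.mono (range_resid_subset hu)).hasFDerivAt_avgGrad hδ (continuous_resid _ u)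
    (h.integrable_condDens h.param_mem hu) (h.condDens_nonneg h.param_mem hu)
    (h.ae_differentiableAt_gradient hu)).1

theorem integral_fderiv_gradient {u : ℝ} (hu : u ∈ M.indexSupp M.trueParam) :
    ∫ y, M.condDens M.trueParam u y •
      fderiv ℝ (gradient M.loss) (M.resid M.trueParam u y) ∂(surf d) = M.hessMap u := by
  have hint := h.integrable_fderiv_gradient hu
  refine ContinuousLinearMap.coe_injective
    ((EuclideanSpace.basisFun (Fin d) ℝ).toBasis.ext fun j => ?_)
  ext i
  have h1 := hint.apply_continuousLinearMap (EuclideanSpace.single j (1 : ℝ))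
  simp only [OrthonormalBasis.coe_toBasis, EuclideanSpace.basisFun_apply,
    ContinuousLinearMap.coe_coe]
  rw [ContinuousLinearMap.integral_apply hint]
  have h2 := (PiLp.proj 2 (fun _ : Fin d => ℝ) i : E d →L[ℝ] ℝ).integral_comp_comm h1
  simp only [PiLp.proj_apply] at h2
  rw [← h2]
  simp [hessMap, matrixMap_apply, F, condExpY, hess, mul_comm]

theorem hasFDerivAt_meanGrad {u : ℝ} (hu : u ∈ M.indexSupp M.trueParam) :
    HasFDerivAt (M.meanGrad u) (M.hessMap u) 0 := by
  obtain ⟨δ, hδ, C, hC, hs⟩ := h.exists_smoothNear_residuals h.param_mem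
  rw [← h.integral_fderiv_gradient hu]
  exact ((hs.mono (range_resid_subset hu)).hasFDerivAt_avgGrad hδ (continuous_resid _ u)
    (h.integrable_condDens h.param_mem hu) (h.condDens_nonneg h.param_mem hu)
    (h.ae_differentiableAt_gradient hu)).2

theorem meanGrad_zero {u : ℝ} (hu : u ∈ M.indexSupp M.trueParam) : M.meanGrad u 0 = 0 :=
  h.avgGrad_eq_zero h.param_mem hu

theorem isLittleO_zeta {u : ℝ} (hu : u ∈ M.indexSupp M.trueParam) :
    (fun t => M.zeta M.trueParam u t - M.zeta M.trueParam u 0 -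
      1 / 2 * inner ℝ (M.hessMap u t) t) =o[𝓝 0] fun t => ‖t‖ ^ 2 := by
  obtain ⟨δ, hδ, C, hC, hs⟩ := h.exists_smoothNear_residuals h.param_mem
  rw [← h.integral_fderiv_gradient hu]
  exact (hs.mono (range_resid_subset hu)).isLittleO_avgLoss hδ hC h.continuous_loss
    (continuous_resid _ u) (h.integrable_condDens h.param_mem hu)
    (h.condDens_nonneg h.param_mem hu) (h.ae_differentiableAt_gradient hu) (h.meanGrad_zero hu)

/-- Uniform bounds on the conditional risk near its minimizer. -/
theorem exists_uniform_bounds : ∃ δ > 0, ∃ C, 0 ≤ C ∧ ∀ u ∈ M.indexSupp M.trueParam,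
    ∀ t : E d, ‖t‖ < δ → ‖M.meanGrad u t‖ ≤ C * ‖t‖ ∧
      |M.zeta M.trueParam u t - M.zeta M.trueParam u 0| ≤ C * ‖t‖ ^ 2 := by
  obtain ⟨δ, hδ, C, hC, hs⟩ := h.exists_smoothNear_residuals h.param_mem
  refine ⟨δ, hδ, C, hC, fun u hu t ht => ⟨?_, ?_⟩⟩
  · have := (hs.mono (range_resid_subset hu)).norm_avgGrad_sub_le (continuous_resid _ u)
      (h.integrable_condDens h.param_mem hu) (h.condDens_nonneg h.param_mem hu)
      (h.integral_condDens h.param_mem hu) ht (t' := 0) (by simpa using hδ)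
    rwa [h.avgGrad_eq_zero h.param_mem hu, sub_zero, sub_zero] at this
  · exact (hs.mono (range_resid_subset hu)).abs_avgLoss_sub_le hC h.continuous_loss
      (continuous_resid _ u) (h.integrable_condDens h.param_mem hu)
      (h.condDens_nonneg h.param_mem hu) (h.integral_condDens h.param_mem hu)
      (h.meanGrad_zero hu) ht

/-- A closed ball around the true parameter on which the link functions are Lipschitz in the
parameter. -/
theorem exists_lipschitz_shift : ∃ ρ > 0, Metric.closedBall M.trueParam ρ ⊆ Param q ∧
    ∃ L > 0, ∀ x ∈ M.predictors, ∀ θ ∈ Metric.closedBall M.trueParam ρ,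
      ‖M.shift θ x‖ ≤ L * ‖θ - M.trueParam‖ := by
  obtain ⟨ρ, hρ, hsub⟩ := Metric.nhds_basis_closedBall.mem_iff.1
    (isOpen_param.mem_nhds h.param_mem)
  obtain ⟨L, hL, hlip⟩ := h.a2.1 _ hsub (isCompact_closedBall _ _)
  refine ⟨ρ, hρ, hsub, L, hL, fun x hx θ hθ => ?_⟩
  rw [← norm_sub_rev M.trueParam θ]
  exact hlip x hx _ (Metric.mem_closedBall_self hρ.le) θ hθ

theorem hasFDerivAt_shift {x : E (q + 1)} (hx : x ∈ M.predictors) :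
    HasFDerivAt (fun θ => M.shift θ x) (-M.pathDeriv x) M.trueParam :=
  (h.hasFDerivAt_path hx).const_sub _

end Regular

end Model

namespace Model

variable {q d : ℕ} {M : Model q d}

/-! ### The derivative of the link function in the parameter -/

theorem aestronglyMeasurable_of_continuousOn {G : Type*} [NormedAddCommGroup G]
    [SecondCountableTopology G] {θ : E q} {g : ℝ → G} (hg : ContinuousOn g (M.indexSupp θ)) :
    AEStronglyMeasurable g (M.indexLaw θ) := by
  borelize G
  obtain ⟨m, hm, hmeq⟩ := exists_measurable_eqOn (isClosed_indexSupp θ) hg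
  refine hm.aestronglyMeasurable.congr ?_
  filter_upwards [ae_mem_indexSupp (M := M) θ] with u hu using hmeq hu

/-- A function that is continuous on the support of the index and vanishes almost everywhere
vanishes on the support. -/
theorem eq_zero_of_ae_eq_zero {G : Type*} [NormedAddCommGroup G] {θ : E q} {g : ℝ → G}
    (hg : ContinuousOn g (M.indexSupp θ)) (h0 : ∀ᵐ u ∂M.indexLaw θ, g u = 0) {u : ℝ}
    (hu : u ∈ M.indexSupp θ) : g u = 0 := by
  by_contra hne
  have h1 : ∀ᶠ v in 𝓝[M.indexSupp θ] u, g v ≠ 0 :=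
    (hg u hu).eventually_ne hne
  rw [eventually_nhdsWithin_iff] at h1
  have h2 : 0 < M.indexLaw θ {v | v ∈ M.indexSupp θ → g v ≠ 0} :=
    (Measure.mem_support_iff_forall u).1 hu _ h1
  refine h2.ne' ?_
  rw [measure_eq_zero_iff_ae_notMem]
  filter_upwards [h0, ae_mem_indexSupp (M := M) θ] with v hv hv' hcon
  exact hcon hv' hv

theorem inner_hessMap {u : ℝ} (v w : E d) :
    inner ℝ (M.hessMap u v) w = w.ofLp ⬝ᵥ (M.F M.trueParam u *ᵥ v.ofLp) := by
  simp [hessMap, matrixMap_apply, PiLp.inner_apply, dotProduct]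

namespace Regular

variable (h : M.Regular)

include h

theorem integrable_comp_index {G : Type*} [NormedAddCommGroup G]
    [SecondCountableTopology G] {θ : E q} {g : ℝ → G} (hg : ContinuousOn g (M.indexSupp θ)) :
    Integrable g (M.indexLaw θ) := by
  have := h.isProbabilityMeasure_indexLaw θ
  obtain ⟨A, hA⟩ := (h.isCompact_indexSupp θ).exists_bound_of_continuousOn hg
  refine Integrable.of_bound (aestronglyMeasurable_of_continuousOn hg) A ?_
  filter_upwards [ae_mem_indexSupp (M := M) θ] with u hu using hA u hu

/-- The derivative at `θ₀` of `integral_meanGrad_shift` along a line in direction `η`. The weight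
`φ` contributes nothing, because `meanGrad` vanishes at zero shift. -/
theorem integral_smul_hessMap_pathDeriv {φ : ℝ → ℝ} (hφ : Continuous φ)
    (hφc : HasCompactSupport φ) (η : E q) :
    ∫ x, φ (index M.trueParam x) • M.hessMap (index M.trueParam x) (M.pathDeriv x η)
      ∂M.predLaw = 0 := by
  have := h.isProbabilityMeasure_predLaw
  obtain ⟨δ, hδ, C, hC, hbd⟩ := h.exists_uniform_bounds
  obtain ⟨ρ, hρ, hsub, L, hL, hlip⟩ := h.exists_lipschitz_shift
  obtain ⟨B, hB⟩ := hφc.exists_bound_of_continuous hφ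
  have hB0 : 0 ≤ B := (norm_nonneg _).trans (hB 0)
  let path : ℝ → E q := fun s => M.trueParam + s • η
  have hpath : HasDerivAt path η 0 := by
    simpa [path] using ((hasDerivAt_id (0 : ℝ)).smul_const η).const_add M.trueParam
  have hpath0 : path 0 = M.trueParam := by simp [path]
  have hpathc : Continuous path := by fun_prop
  have hnorm : ∀ s, ‖path s - M.trueParam‖ = |s| * ‖η‖ := fun s => by
    simp [path, norm_smul]
  let f : ℝ → E (q + 1) → E d := fun s x =>
    s⁻¹ • φ (index (path s) x) • M.meanGrad (index M.trueParam x) (M.shift (path s) x)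
  have hball : ∀ᶠ s in 𝓝[≠] (0 : ℝ), path s ∈ Metric.closedBall M.trueParam ρ := by
    refine nhdsWithin_le_nhds (hpathc.continuousAt.eventually_mem ?_)
    rw [hpath0]
    exact Metric.closedBall_mem_nhds _ hρ
  have hsmall : ∀ᶠ s in 𝓝[≠] (0 : ℝ), L * (|s| * ‖η‖) < δ := by
    refine nhdsWithin_le_nhds (((by fun_prop :
      Continuous fun s : ℝ => L * (|s| * ‖η‖)).tendsto' 0 0 (by simp)).eventually
        (gt_mem_nhds hδ))
  have hlim : Tendsto (fun s => ∫ x, f s x ∂M.predLaw) (𝓝[≠] 0)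
      (𝓝 (∫ x, φ (index M.trueParam x) •
        M.hessMap (index M.trueParam x) (-(M.pathDeriv x η)) ∂M.predLaw)) := by
    -- `B` bounds `φ`, `C` is the Lipschitz constant of `meanGrad` at the origin, and `L * ‖η‖`
    -- bounds the shift divided by `|s|`.
    refine tendsto_integral_filter_of_dominated_convergence
      (fun _ => B * (C * (L * ‖η‖))) ?_ ?_ (integrable_const _) ?_
    · filter_upwards [hball] with s hs
      exact (h.integral_meanGrad_shift (hsub hs) hφ).1.1.const_smul s⁻¹
    · filter_upwards [hball, hsmall, self_mem_nhdsWithin] with s hs hs' hs0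
      filter_upwards [h.ae_mem_predictors] with x hx
      have h1 := hlip x hx _ hs
      rw [hnorm] at h1
      have h2 := (hbd _ (h.index_mem h.param_mem hx) _ (h1.trans_lt hs')).1
      have hs0' : 0 < |s| := abs_pos.2 hs0
      simp only [f, norm_smul, norm_inv, Real.norm_eq_abs]
      rw [inv_mul_le_iff₀ hs0']
      have h3 := hB (index (path s) x)
      rw [Real.norm_eq_abs] at h3
      calc _ ≤ B * (C * (L * (|s| * ‖η‖))) := by gcongr; exact h2.trans (by gcongr)
        _ = _ := by ring
    · filter_upwards [h.ae_mem_predictors] with x hx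
      have hu := h.index_mem h.param_mem hx
      have h1 : HasDerivAt (fun s => M.shift (path s) x) (-(M.pathDeriv x η)) 0 := by
        have := h.hasFDerivAt_shift hx
        rw [← hpath0] at this
        exact this.comp_hasDerivAt 0 hpath
      have h2 : HasDerivAt (fun s => M.meanGrad (index M.trueParam x) (M.shift (path s) x))
          (M.hessMap (index M.trueParam x) (-(M.pathDeriv x η))) 0 := by
        have h3 := h.hasFDerivAt_meanGrad hu
        have h4 : M.shift (path 0) x = 0 := by rw [hpath0, shift_trueParam]
        rw [← h4] at h3
        exact h3.comp_hasDerivAt 0 h1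
      have h5 := hasDerivAt_iff_tendsto_slope_zero.1 h2
      simp only [zero_add, hpath0, shift_trueParam, h.meanGrad_zero hu, sub_zero] at h5
      -- Continuity of `φ` is enough, since it multiplies a quotient that already converges.
      have h6 : Tendsto (fun s => φ (index (path s) x)) (𝓝[≠] 0)
          (𝓝 (φ (index M.trueParam x))) := by
        have hi : Continuous fun s => index (path s) x :=
          continuous_const.inner (continuous_beta.comp hpathc)
        exact ((hφ.comp hi).tendsto' 0 _ (by simp only [Function.comp, hpath0])).mono_left
          nhdsWithin_le_nhds
      refine (h6.smul h5).congr fun s => ?_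
      simp only [f]
      rw [smul_comm]
  have hzero : ∀ᶠ s in 𝓝[≠] (0 : ℝ), ∫ x, f s x ∂M.predLaw = 0 := by
    filter_upwards [hball] with s hs
    simp only [f]
    rw [integral_smul, (h.integral_meanGrad_shift (hsub hs) hφ).2, smul_zero]
  have h0 := tendsto_nhds_unique (hlim.congr' hzero) tendsto_const_nhds
  simpa [integral_neg] using h0

/-- Functions of the index integrate against `X` as against its conditional mean. -/
theorem integral_inner_smul {G : Type*} [NormedAddCommGroup G] [NormedSpace ℝ G]
    [CompleteSpace G] [SecondCountableTopology G] {g : ℝ → G}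
    (hg : ContinuousOn g (M.indexSupp M.trueParam)) (a : E (q + 1)) :
    Integrable (fun x => (inner ℝ x a : ℝ) • g (index M.trueParam x)) M.predLaw ∧
    ∫ x, (inner ℝ x a : ℝ) • g (index M.trueParam x) ∂M.predLaw =
      ∫ x, (inner ℝ (M.condMean (index M.trueParam x)) a : ℝ) • g (index M.trueParam x)
        ∂M.predLaw := by
  have := h.prob
  borelize G
  set U : E (q + 1) × Sph d → ℝ := fun z => index M.trueParam z.1 with hU
  have hUm : Measurable U := measurable_index _
  have hle : MeasurableSpace.comap U inferInstance ≤
      (inferInstance : MeasurableSpace (E (q + 1) × Sph d)) := hUm.comap_le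
  obtain ⟨m, hm, hmeq⟩ := exists_measurable_eqOn (isClosed_indexSupp _) hg
  obtain ⟨e, he, heeq⟩ := exists_measurable_eqOn (isClosed_indexSupp _) h.mean.1
  obtain ⟨A, hA⟩ := (h.isCompact_indexSupp M.trueParam).exists_bound_of_continuousOn hg
  obtain ⟨B, hB⟩ := h.a1.1.exists_bound_of_continuousOn continuousOn_id
  let T : G →L[ℝ] E (q + 1) →L[ℝ] G :=
    ((ContinuousLinearMap.smulRightL ℝ (E (q + 1)) G) (innerSL ℝ a))
  have hT : ∀ v x, T v x = (inner ℝ x a : ℝ) • v := fun v x => by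
    simp [T, real_inner_comm]
  have hX : Integrable (fun z : E (q + 1) × Sph d => z.1) M.law := by
    refine Integrable.of_bound measurable_fst.aestronglyMeasurable B ?_
    filter_upwards [h.a1.2.1] with z hz using hB _ hz
  have hsm : AEStronglyMeasurable[MeasurableSpace.comap U inferInstance]
      (fun z => m (U z)) M.law :=
    (hm.stronglyMeasurable.comp_measurable (comap_measurable U)).aestronglyMeasurable
  have hmeas : Measurable fun z : E (q + 1) × Sph d => (inner ℝ z.1 a : ℝ) • m (U z) :=
    (measurable_fst.inner measurable_const).smul (hm.comp hUm)
  have hTX : Integrable (fun z : E (q + 1) × Sph d => (inner ℝ z.1 a : ℝ) • m (U z)) M.law := by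
    refine Integrable.of_bound hmeas.aestronglyMeasurable (B * ‖a‖ * A) ?_
    filter_upwards [h.a1.2.1, ae_index_mem (M := M) M.trueParam] with z hz hz'
    rw [norm_smul]
    have h1 : ‖m (U z)‖ ≤ A := by rw [hmeq hz']; exact hA _ hz'
    have h2 : ‖z.1‖ ≤ B := hB _ hz
    have h0 : 0 ≤ B := (norm_nonneg _).trans h2
    refine mul_le_mul ((norm_inner_le_norm _ _).trans ?_) h1 (norm_nonneg _) (by positivity)
    gcongr
  -- Pull-out property: `m (U z)` is measurable for the σ-algebra of the index, so conditioning acts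
  -- on the predictor alone.
  have key := condExp_bilin_of_aestronglyMeasurable_left (m := MeasurableSpace.comap U inferInstance)
    (μ := M.law) T (f := fun z => m (U z)) (g := fun z => z.1) hsm (by simpa only [hT] using hTX) hX
  have h1 := integral_condExp (μ := M.law) hle (f := fun z => T (m (U z)) z.1)
  rw [integral_congr_ae key] at h1
  simp only [hT] at h1
  have hfst : ∀ {F : E (q + 1) → G}, AEStronglyMeasurable F M.predLaw →
      ∫ x, F x ∂M.predLaw = ∫ z, F z.1 ∂M.law := fun hF =>
    integral_map measurable_fst.aemeasurable hF
  have hidx : Measurable (index M.trueParam : E (q + 1) → ℝ) :=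
    (continuous_index_right _).measurable
  have hae1 : (fun x => (inner ℝ x a : ℝ) • m (index M.trueParam x)) =ᵐ[M.predLaw]
      fun x => (inner ℝ x a : ℝ) • g (index M.trueParam x) := by
    filter_upwards [ae_predLaw_index_mem (M := M) M.trueParam] with x hx
    rw [hmeq hx]
  have hae2 : (fun x => (inner ℝ (e (index M.trueParam x)) a : ℝ) • m (index M.trueParam x))
      =ᵐ[M.predLaw] fun x => (inner ℝ (M.condMean (index M.trueParam x)) a : ℝ) •
        g (index M.trueParam x) := by
    filter_upwards [ae_predLaw_index_mem (M := M) M.trueParam] with x hx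
    rw [hmeq hx, heeq hx]
  have hm1 : Measurable fun x : E (q + 1) => (inner ℝ x a : ℝ) • m (index M.trueParam x) :=
    (measurable_id.inner measurable_const).smul (hm.comp hidx)
  have hm2 : Measurable fun x : E (q + 1) =>
      (inner ℝ (e (index M.trueParam x)) a : ℝ) • m (index M.trueParam x) :=
    ((he.comp hidx).inner measurable_const).smul (hm.comp hidx)
  constructor
  · refine Integrable.congr ?_ hae1
    exact (integrable_map_measure hm1.aestronglyMeasurable measurable_fst.aemeasurable).2 hTX
  · rw [← integral_congr_ae hae1, ← integral_congr_ae hae2, hfst hm1.aestronglyMeasurable,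
      hfst hm2.aestronglyMeasurable, ← h1]
    refine integral_congr_ae ?_
    filter_upwards [h.mean.2, ae_index_mem (M := M) M.trueParam] with z hz hz'
    rw [heeq hz', ← hz]

theorem continuousOn_hessMap_apply {g : ℝ → E d}
    (hg : ContinuousOn g (M.indexSupp M.trueParam)) :
    ContinuousOn (fun u => M.hessMap u (g u)) (M.indexSupp M.trueParam) := by
  have h1 : ContinuousOn (M.F M.trueParam) (M.indexSupp M.trueParam) :=
    h.a3.2.2.2.1.comp (f := fun u : ℝ => (M.trueParam, u)) (by fun_prop)
      fun _ hu => ⟨h.param_mem, hu⟩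
  have h2 : Continuous fun w : Matrix (Fin d) (Fin d) ℝ × E d =>
      (WithLp.toLp 2 (w.1 *ᵥ w.2.ofLp) : E d) :=
    (PiLp.continuous_toLp 2 _).comp
      (Continuous.matrix_mulVec continuous_fst ((PiLp.continuous_ofLp 2 _).comp continuous_snd))
  exact h2.comp_continuousOn (h1.prodMk hg)

theorem posDef_F {u : ℝ} (hu : u ∈ M.indexSupp M.trueParam) :
    (M.F M.trueParam u).PosDef := (h.a3.2.2.2.2 _ h.param_mem u hu).2

theorem hessMap_pos {u : ℝ} (hu : u ∈ M.indexSupp M.trueParam) {v : E d} (hv : v ≠ 0) :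
    0 < (inner ℝ (M.hessMap u v) v : ℝ) := by
  have h1 := (h.posDef_F hu).dotProduct_mulVec_pos (x := v.ofLp) (by simpa using hv)
  rw [inner_hessMap]
  simpa using h1

/-- The derivative of the link function in the parameter. -/
theorem linkParamDeriv_eq {u : ℝ} (hu : u ∈ M.indexSupp M.trueParam) (η : E q) :
    M.linkParamDeriv u η =
      -((inner ℝ (M.condMean u) (matrixMap (jac M.trueParam) η) : ℝ) •
        M.linkDeriv M.trueParam u) := by
  set a := matrixMap (jac M.trueParam) η with ha
  have hc1 : ContinuousOn (fun u => M.hessMap u (M.linkParamDeriv u η))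
      (M.indexSupp M.trueParam) :=
    h.continuousOn_hessMap_apply (h.continuousOn_linkParamDeriv η)
  have hc2 : ContinuousOn (fun u => M.hessMap u (M.linkDeriv M.trueParam u))
      (M.indexSupp M.trueParam) :=
    h.continuousOn_hessMap_apply h.continuousOn_linkDeriv
  have hcm : ContinuousOn (fun u => (inner ℝ (M.condMean u) a : ℝ)) (M.indexSupp M.trueParam) :=
    h.mean.1.inner continuousOn_const
  -- The conditional mean, given the index, of `F(U)` applied to the path derivative. It tests to
  -- zero against all smooth `φ`, hence vanishes almost everywhere and, by continuity, on the whole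
  -- support.
  let b : ℝ → E d := fun u => M.hessMap u (M.linkParamDeriv u η) +
    (inner ℝ (M.condMean u) a : ℝ) • M.hessMap u (M.linkDeriv M.trueParam u)
  have hb : ContinuousOn b (M.indexSupp M.trueParam) := hc1.add (hcm.smul hc2)
  have hidx : Measurable (index M.trueParam : E (q + 1) → ℝ) :=
    (continuous_index_right _).measurable
  have hint : ∀ {g : ℝ → E d}, ContinuousOn g (M.indexSupp M.trueParam) →
      Integrable (fun x => g (index M.trueParam x)) M.predLaw := by
    intro g hg
    have := h.integrable_comp_index hg
    rw [← map_index_predLaw] at this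
    exact this.comp_measurable hidx
  have hb0 : ∀ᵐ v ∂M.indexLaw M.trueParam, b v = 0 := by
    have := h.isProbabilityMeasure_indexLaw M.trueParam
    refine ae_eq_zero_of_integral_contDiff_smul_eq_zero
      (h.integrable_comp_index hb).locallyIntegrable fun φ hφ hφc => ?_
    have hφ' : Continuous φ := hφ.continuous
    have h1 := h.integral_smul_hessMap_pathDeriv hφ' hφc η
    have hs1 : ContinuousOn (fun u => φ u • M.hessMap u (M.linkParamDeriv u η))
        (M.indexSupp M.trueParam) := hφ'.continuousOn.smul hc1
    have hs2 : ContinuousOn (fun u => φ u • M.hessMap u (M.linkDeriv M.trueParam u))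
        (M.indexSupp M.trueParam) := hφ'.continuousOn.smul hc2
    have hs3 : ContinuousOn (fun u => (inner ℝ (M.condMean u) a : ℝ) • φ u •
        M.hessMap u (M.linkDeriv M.trueParam u)) (M.indexSupp M.trueParam) := hcm.smul hs2
    have h2 := h.integral_inner_smul hs2 a
    have h3 : ∫ x, φ (index M.trueParam x) •
        M.hessMap (index M.trueParam x) (M.pathDeriv x η) ∂M.predLaw =
        ∫ x, (φ (index M.trueParam x) • M.hessMap (index M.trueParam x)
          (M.linkParamDeriv (index M.trueParam x) η) + (inner ℝ x a : ℝ) •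
          (φ (index M.trueParam x) • M.hessMap (index M.trueParam x)
          (M.linkDeriv M.trueParam (index M.trueParam x)))) ∂M.predLaw := by
      refine integral_congr_ae ?_
      filter_upwards [h.ae_mem_predictors] with x hx
      rw [h.pathDeriv_apply hx, map_add, map_smul, smul_add, smul_comm (φ _)]
      rfl
    rw [h3, integral_add (hint hs1) h2.1, h2.2, ← integral_add (hint hs1) (hint hs3)] at h1
    have h4 : AEStronglyMeasurable (fun v => φ v • b v) (M.predLaw.map (index M.trueParam)) := by
      rw [map_index_predLaw]
      exact aestronglyMeasurable_of_continuousOn (hφ'.continuousOn.smul hb)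
    rw [← map_index_predLaw, integral_map hidx.aemeasurable h4, ← h1]
    refine integral_congr_ae (Eventually.of_forall fun x => ?_)
    simp only [b, smul_add]
    rw [smul_comm (φ _)]
  have hbu := eq_zero_of_ae_eq_zero hb hb0 hu
  have h5 : M.hessMap u (M.linkParamDeriv u η +
      (inner ℝ (M.condMean u) a : ℝ) • M.linkDeriv M.trueParam u) = 0 := by
    rw [map_add, map_smul]; exact hbu
  -- Positive definiteness of `F` makes `hessMap` injective.
  by_contra hne
  have h6 := h.hessMap_pos hu (v := M.linkParamDeriv u η +
      (inner ℝ (M.condMean u) a : ℝ) • M.linkDeriv M.trueParam u)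
    (fun h0 => hne (eq_neg_of_add_eq_zero_left h0))
  rw [h5, inner_zero_left] at h6
  exact lt_irrefl _ h6

/-- The response of the link to the parameter cancels the part of `x` that the index predicts, so
only the centred predictor remains. -/
theorem pathDeriv_eq {x : E (q + 1)} (hx : x ∈ M.predictors) (η : E q) :
    M.pathDeriv x η = (inner ℝ (M.centered x) (matrixMap (jac M.trueParam) η) : ℝ) •
      M.linkDeriv M.trueParam (index M.trueParam x) := by
  rw [h.pathDeriv_apply hx, h.linkParamDeriv_eq (h.index_mem h.param_mem hx), centered,
    inner_sub_left, sub_smul, neg_add_eq_sub]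
  rfl

end Regular

end Model

namespace Model

variable {q d : ℕ} {M : Model q d}

/-! ### The risk near the true parameter -/

/-- The loss of the observation `z` at the parameter `θ`. -/
noncomputable def obsLoss (M : Model q d) (z : E (q + 1) × Sph d) (θ : E q) : ℝ :=
  M.loss (M.resid θ (index θ z.1) z.2)

/-- The curvature `μ'ᵀ F μ'` of the conditional risk along the link function. -/
noncomputable def curvature (M : Model q d) (u : ℝ) : ℝ :=
  inner ℝ (M.hessMap u (M.linkDeriv M.trueParam u)) (M.linkDeriv M.trueParam u)

namespace Regular

variable (h : M.Regular)

include h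

theorem continuousOn_obsLoss {B : Set (E q)} (hB : B ⊆ Param q) :
    ContinuousOn (fun w : (E (q + 1) × Sph d) × E q => M.obsLoss w.1 w.2)
      ((M.predictors ×ˢ univ) ×ˢ B) := by
  refine h.continuous_loss.comp_continuousOn ?_
  refine ContinuousOn.sub (by fun_prop) ?_
  exact h.continuousOn_link_index.comp
    (f := fun w : (E (q + 1) × Sph d) × E q => (w.2, w.1.1)) (by fun_prop)
    fun w hw => ⟨hB hw.2, hw.1.1⟩

theorem exists_bound_obsLoss {B : Set (E q)} (hB : B ⊆ Param q) (hBc : IsCompact B) :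
    ∃ A, ∀ z ∈ M.observations, ∀ θ ∈ B, ‖M.obsLoss z θ‖ ≤ A := by
  obtain ⟨A, hA⟩ := ((h.a1.1.prod isCompact_univ).prod hBc).exists_bound_of_continuousOn
    (h.continuousOn_obsLoss hB)
  exact ⟨A, fun z hz θ hθ => hA (z, θ) ⟨⟨hz, mem_univ _⟩, hθ⟩⟩

theorem continuousOn_obsLoss_param {z : E (q + 1) × Sph d} (hz : z ∈ M.observations) :
    ContinuousOn (M.obsLoss z) (Param q) :=
  (h.continuousOn_obsLoss subset_rfl).comp (f := fun θ => (z, θ)) (by fun_prop)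
    fun _ hθ => ⟨⟨hz, mem_univ _⟩, hθ⟩

theorem aestronglyMeasurable_obsLoss {θ : E q} (hθ : θ ∈ Param q) :
    AEStronglyMeasurable (fun z => M.obsLoss z θ) M.law := by
  obtain ⟨m, hm, hmeq⟩ := h.measurable_resid_index hθ
  have h1 : Measurable fun z : E (q + 1) × Sph d => M.loss (m (index θ z.1, z.2)) :=
    h.continuous_loss.measurable.comp (hm.comp ((measurable_index θ).prodMk measurable_snd))
  refine h1.aestronglyMeasurable.congr ?_
  filter_upwards [ae_index_mem (M := M) θ] with z hz
  rw [hmeq _ hz, obsLoss]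

theorem integrable_obsLoss {θ : E q} (hθ : θ ∈ Param q) :
    Integrable (fun z => M.obsLoss z θ) M.law := by
  have := h.prob
  obtain ⟨A, hA⟩ := h.exists_bound_obsLoss (singleton_subset_iff.2 hθ) isCompact_singleton
  refine Integrable.of_bound (h.aestronglyMeasurable_obsLoss hθ) A ?_
  filter_upwards [h.a1.2.1] with z hz using hA z hz θ rfl

theorem risk_eq {θ : E q} (hθ : θ ∈ Param q) :
    Integrable (fun x => M.zeta M.trueParam (index M.trueParam x) (M.shift θ x)) M.predLaw ∧
    M.risk M.law θ =
      ∫ x, M.zeta M.trueParam (index M.trueParam x) (M.shift θ x) ∂M.predLaw := by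
  have h1 := h.integral_law (h.integrable_obsLoss hθ)
  have h2 : ∀ x, ∫ y, M.condDens M.trueParam (index M.trueParam x) y •
      M.obsLoss (x, y) θ ∂(surf d) =
      M.zeta M.trueParam (index M.trueParam x) (M.shift θ x) := by
    intro x
    simp only [obsLoss, zeta, condExpY, smul_eq_mul, mul_comm, resid_eq_add_shift θ x]
  simp only [h2] at h1
  exact h1

theorem continuousOn_risk {B : Set (E q)} (hB : B ⊆ Param q) (hBc : IsCompact B) :
    ContinuousOn (M.risk M.law) B := by
  have := h.prob
  obtain ⟨A, hA⟩ := h.exists_bound_obsLoss hB hBc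
  refine continuousOn_of_dominated (F := fun θ z => M.obsLoss z θ) (bound := fun _ => A)
    (fun θ hθ => h.aestronglyMeasurable_obsLoss (hB hθ)) (fun θ hθ => ?_) (integrable_const _) ?_
  · filter_upwards [h.a1.2.1] with z hz using hA z hz θ hθ
  · filter_upwards [h.a1.2.1] with z hz using (h.continuousOn_obsLoss_param hz).mono hB

/-- Given `X`, the conditional risk has its strict minimum at zero shift by (A4), and by the
identifiability in (A2) the shift is nonzero with positive probability. -/
theorem risk_lt {θ : E q} (hθ : θ ∈ Param q) (hne : θ ≠ M.trueParam) :
    M.risk M.law M.trueParam < M.risk M.law θ := by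
  have h1 := h.risk_eq hθ
  have h2 := h.risk_eq h.param_mem
  rw [h1.2, h2.2]
  have hlt : ∀ x ∈ M.predictors, M.shift θ x ≠ 0 →
      M.zeta M.trueParam (index M.trueParam x) (M.shift M.trueParam x) <
      M.zeta M.trueParam (index M.trueParam x) (M.shift θ x) := fun x hx hs => by
    rw [shift_trueParam]
    exact (h.a4 _ h.param_mem _ (h.index_mem h.param_mem hx)).1 _ hs
  have hle : ∀ᵐ x ∂M.predLaw,
      M.zeta M.trueParam (index M.trueParam x) (M.shift M.trueParam x) ≤
      M.zeta M.trueParam (index M.trueParam x) (M.shift θ x) := by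
    filter_upwards [h.ae_mem_predictors] with x hx
    by_cases hs : M.shift θ x = 0
    · rw [hs, shift_trueParam]
    · exact (hlt x hx hs).le
  rw [← sub_pos, ← integral_sub h1.1 h2.1, integral_pos_iff_support_of_nonneg_ae
    (hle.mono fun x hx => sub_nonneg.2 hx) (h1.1.sub h2.1)]
  have h3 := h.a2.2 θ hθ hne
  -- An inequality suffices here, and it holds without measurability of the set.
  have h4 : M.law {z | M.link θ (index θ z.1) ≠ M.link M.trueParam (index M.trueParam z.1)} ≤
      M.predLaw {x | M.shift θ x ≠ 0} := by
    refine le_trans (measure_mono fun z hz => ?_)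
      (Measure.le_map_apply measurable_fst.aemeasurable _)
    exact fun h0 => hz (sub_eq_zero.1 h0).symm
  refine (h3.trans_le h4).trans_le (measure_mono_ae ?_)
  filter_upwards [h.ae_mem_predictors] with x hx hs using (sub_pos.2 (hlt x hx hs)).ne'

/-- The bounds on `ε` make the truncations `ENNReal.ofReal` in `contaminated` exact. The affine form
is the input of `tendsto_slope_perturbed_min`. -/
theorem risk_contaminated {θ : E q} (hθ : θ ∈ Param q) {ε : ℝ} (h0 : 0 ≤ ε) (h1 : ε ≤ 1)
    (z : E (q + 1) × Sph d) :
    M.risk (M.contaminated z ε) θ = (1 - ε) * M.risk M.law θ + ε * M.obsLoss z θ := by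
  have hi := h.integrable_obsLoss hθ
  have hi' : Integrable (fun z => M.obsLoss z θ) (Measure.dirac z) := integrable_dirac (by simp)
  change ∫ w, M.obsLoss w θ ∂(M.contaminated z ε) = _
  rw [contaminated, integral_add_measure (hi.smul_measure ENNReal.ofReal_ne_top)
    (hi'.smul_measure ENNReal.ofReal_ne_top), integral_smul_measure, integral_smul_measure,
    integral_dirac, ENNReal.toReal_ofReal (by linarith), ENNReal.toReal_ofReal h0]
  rfl

theorem integrable_of_continuousOn {G : Type*} [NormedAddCommGroup G] {g : E (q + 1) → G}
    (hg : ContinuousOn g M.predictors) : Integrable g M.predLaw := by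
  have := h.isProbabilityMeasure_predLaw
  have h1 := hg.integrableOn_compact (μ := M.predLaw) h.a1.1
  rwa [IntegrableOn, Measure.restrict_eq_self_of_ae_mem h.ae_mem_predictors] at h1

theorem continuousOn_comp_index {G : Type*} [TopologicalSpace G] {g : ℝ → G}
    (hg : ContinuousOn g (M.indexSupp M.trueParam)) :
    ContinuousOn (fun x => g (index M.trueParam x)) M.predictors :=
  hg.comp (continuous_index_right _).continuousOn fun _ hx => h.index_mem h.param_mem hx

theorem continuousOn_centered : ContinuousOn M.centered M.predictors :=
  continuousOn_id.sub (h.continuousOn_comp_index h.mean.1)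

theorem continuousOn_curvature : ContinuousOn M.curvature (M.indexSupp M.trueParam) :=
  (h.continuousOn_hessMap_apply h.continuousOn_linkDeriv).inner h.continuousOn_linkDeriv

theorem curvature_nonneg {u : ℝ} (hu : u ∈ M.indexSupp M.trueParam) : 0 ≤ M.curvature u := by
  by_cases h0 : M.linkDeriv M.trueParam u = 0
  · simp [curvature, h0]
  · exact (h.hessMap_pos hu h0).le

/-- The integrand of the quadratic form of `W₀`. -/
theorem integrable_quadratic (a b : E (q + 1)) :
    Integrable (fun x => M.curvature (index M.trueParam x) *
      ((inner ℝ (M.centered x) a : ℝ) * inner ℝ (M.centered x) b)) M.predLaw :=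
  h.integrable_of_continuousOn ((h.continuousOn_comp_index h.continuousOn_curvature).mul
    ((h.continuousOn_centered.inner continuousOn_const).mul
      (h.continuousOn_centered.inner continuousOn_const)))

theorem inner_hessMap_pathDeriv {x : E (q + 1)} (hx : x ∈ M.predictors) (η : E q) :
    (inner ℝ (M.hessMap (index M.trueParam x) (M.pathDeriv x η)) (M.pathDeriv x η) : ℝ) =
      M.curvature (index M.trueParam x) *
        (inner ℝ (M.centered x) (matrixMap (jac M.trueParam) η) *
          inner ℝ (M.centered x) (matrixMap (jac M.trueParam) η)) := by
  rw [h.pathDeriv_eq hx, map_smul, inner_smul_left, inner_smul_right, curvature]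
  simp only [conj_trivial]
  ring

/-- The second-order expansion of the risk at the true parameter. -/
theorem isLittleO_risk :
    (fun η : E q => M.risk M.law (M.trueParam + η) - M.risk M.law M.trueParam -
      1 / 2 * ∫ x, M.curvature (index M.trueParam x) *
        ((inner ℝ (M.centered x) (matrixMap (jac M.trueParam) η) : ℝ) *
          inner ℝ (M.centered x) (matrixMap (jac M.trueParam) η)) ∂M.predLaw)
      =o[𝓝 0] fun η => ‖η‖ ^ 2 := by
  have := h.isProbabilityMeasure_predLaw
  obtain ⟨δ, hδ, C, hC, hbd⟩ := h.exists_uniform_bounds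
  obtain ⟨ρ, hρ, hsub, L, hL, hlip⟩ := h.exists_lipschitz_shift
  obtain ⟨A, hA⟩ := (h.isCompact_indexSupp M.trueParam).exists_bound_of_continuousOn
    h.continuousOn_curvature
  obtain ⟨B, hB⟩ := h.a1.1.exists_bound_of_continuousOn h.continuousOn_centered
  set J := matrixMap (jac M.trueParam) with hJ
  let Q : E q → E (q + 1) → ℝ := fun η x => M.curvature (index M.trueParam x) *
    ((inner ℝ (M.centered x) (J η) : ℝ) * inner ℝ (M.centered x) (J η))
  let Z : E (q + 1) → E d → ℝ := fun x t => M.zeta M.trueParam (index M.trueParam x) t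
  have hball : ∀ᶠ η in 𝓝 (0 : E q), M.trueParam + η ∈ Metric.closedBall M.trueParam ρ := by
    filter_upwards [Metric.closedBall_mem_nhds (0 : E q) hρ] with η hη
    simpa using hη
  have hsmall : ∀ᶠ η in 𝓝 (0 : E q), L * ‖η‖ < δ :=
    ((by fun_prop : Continuous fun η : E q => L * ‖η‖).tendsto' 0 0 (by simp)).eventually
      (gt_mem_nhds hδ)
  have hlim : Tendsto (fun η => ∫ x, (Z x (M.shift (M.trueParam + η) x) - Z x 0 -
      1 / 2 * Q η x) / ‖η‖ ^ 2 ∂M.predLaw) (𝓝 0) (𝓝 (∫ _, (0 : ℝ) ∂M.predLaw)) := by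
    -- After division by `‖η‖²`, the increment of `ζ` is at most `C * L ^ 2` and the quadratic term
    -- `Q` at most `A * (B * ‖J‖) ^ 2`.
    refine tendsto_integral_filter_of_dominated_convergence
      (fun _ => C * L ^ 2 + 1 / 2 * (A * (B * ‖J‖) ^ 2)) ?_ ?_ (integrable_const _) ?_
    · filter_upwards [hball] with η hη
      have h1 := (h.risk_eq (hsub hη)).1
      have h2 := (h.risk_eq h.param_mem).1
      simp only [shift_trueParam] at h2
      exact (((h1.sub h2).sub ((h.integrable_quadratic _ _).const_mul (1 / 2))).div_const _).1
    · filter_upwards [hball, hsmall] with η hη hη'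
      filter_upwards [h.ae_mem_predictors] with x hx
      have hu := h.index_mem h.param_mem hx
      have h1 := hlip x hx _ hη
      rw [add_sub_cancel_left] at h1
      have h2 := (hbd _ hu _ (h1.trans_lt hη')).2
      have h3 : ‖M.shift (M.trueParam + η) x‖ ^ 2 ≤ L ^ 2 * ‖η‖ ^ 2 := by
        rw [← mul_pow]; exact pow_le_pow_left₀ (norm_nonneg _) h1 2
      have h4 : |(inner ℝ (M.centered x) (J η) : ℝ)| ≤ B * ‖J‖ * ‖η‖ := by
        refine (abs_real_inner_le_norm _ _).trans ?_
        have hB' := hB x hx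
        rw [mul_assoc]
        exact mul_le_mul hB' (J.le_opNorm η) (norm_nonneg _) ((norm_nonneg _).trans hB')
      have h5 : |Q η x| ≤ A * ((B * ‖J‖) ^ 2 * ‖η‖ ^ 2) := by
        simp only [Q]
        rw [abs_mul, abs_mul, ← pow_two, ← mul_pow]
        have hA' := hA _ hu
        exact mul_le_mul hA' (pow_le_pow_left₀ (abs_nonneg _) h4 2) (by positivity)
          ((norm_nonneg _).trans hA')
      rw [norm_div, norm_pow, norm_norm]
      refine div_le_of_le_mul₀ (by positivity) ?_ ?_
      · have hA0 : 0 ≤ A := (norm_nonneg _).trans (hA _ hu)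
        positivity
      · calc _ ≤ |Z x (M.shift (M.trueParam + η) x) - Z x 0| + |1 / 2 * Q η x| := abs_sub _ _
          _ ≤ C * (L ^ 2 * ‖η‖ ^ 2) + 1 / 2 * (A * ((B * ‖J‖) ^ 2 * ‖η‖ ^ 2)) := by
            refine add_le_add (h2.trans (by gcongr)) ?_
            rw [abs_mul, abs_of_pos (by norm_num : (0 : ℝ) < 1 / 2)]
            gcongr
          _ = _ := by ring
    · filter_upwards [h.ae_mem_predictors] with x hx
      have hu := h.index_mem h.param_mem hx
      let t : E q → E d := fun η => M.shift (M.trueParam + η) x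
      set H := M.hessMap (index M.trueParam x)
      set D := M.pathDeriv x
      -- The shift is `-D η` to first order; the sign disappears in the quadratic form.
      have ht : (fun η => t η + D η) =o[𝓝 0] fun η => η := by
        have h1 := hasFDerivAt_iff_isLittleO_nhds_zero.1 (h.hasFDerivAt_shift hx)
        refine h1.congr_left fun η => ?_
        simp [t, shift_trueParam, D]
      have hDO : (fun η => D η) =O[𝓝 0] fun η : E q => η := D.isBigO_id _
      have htO : t =O[𝓝 0] fun η => η := by
        have := ht.isBigO.sub hDO
        simpa using this
      have ht0 : Tendsto t (𝓝 0) (𝓝 0) := htO.trans_tendsto tendsto_id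
      have h1 : (fun η => Z x (t η) - Z x 0 - 1 / 2 * inner ℝ (H (t η)) (t η))
          =o[𝓝 0] fun η => ‖η‖ ^ 2 :=
        ((h.isLittleO_zeta hu).comp_tendsto ht0).trans_isBigO (htO.norm_norm.pow 2)
      have h2 : (fun η => (inner ℝ (H (t η)) (t η) : ℝ) - inner ℝ (H (D η)) (D η))
          =o[𝓝 0] fun η => ‖η‖ ^ 2 := by
        -- Each term on the right contains the small vector `t η + D η`, and no symmetry of `H` is
        -- used.
        have e : ∀ η, (inner ℝ (H (t η)) (t η) : ℝ) - inner ℝ (H (D η)) (D η) =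
            inner ℝ (H (t η)) (t η + D η) - inner ℝ (H (t η + D η)) (D η) := fun η => by
          rw [map_add, inner_add_right, inner_add_left]; ring
        simp only [e]
        have b1 : (fun η => (inner ℝ (H (t η)) (t η + D η) : ℝ)) =o[𝓝 0] fun η => ‖η‖ ^ 2 := by
          have : (fun η => ‖H (t η)‖ * ‖t η + D η‖) =o[𝓝 0] fun η => ‖η‖ * ‖η‖ :=
            (((H.isBigO_comp t _).trans htO).norm_norm).mul_isLittleO ht.norm_norm
          simp only [← pow_two] at this
          refine (Asymptotics.IsBigO.of_bound 1 (Eventually.of_forall fun η => ?_)).trans_isLittleO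
            this
          rw [one_mul, norm_mul, norm_norm, norm_norm]
          exact norm_inner_le_norm _ _
        have b2 : (fun η => (inner ℝ (H (t η + D η)) (D η) : ℝ)) =o[𝓝 0] fun η => ‖η‖ ^ 2 := by
          have : (fun η => ‖H (t η + D η)‖ * ‖D η‖) =o[𝓝 0] fun η => ‖η‖ * ‖η‖ :=
            (((H.isBigO_comp _ _).trans_isLittleO ht).norm_norm).mul_isBigO hDO.norm_norm
          simp only [← pow_two] at this
          refine (Asymptotics.IsBigO.of_bound 1 (Eventually.of_forall fun η => ?_)).trans_isLittleO
            this
          rw [one_mul, norm_mul, norm_norm, norm_norm]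
          exact norm_inner_le_norm _ _
        exact b1.sub b2
      have h3 := (h1.add (h2.const_mul_left (1 / 2))).tendsto_div_nhds_zero
      refine h3.congr fun η => ?_
      simp only [Q]
      rw [← h.inner_hessMap_pathDeriv hx η]
      congr 1
      ring
  rw [integral_zero] at hlim
  refine Asymptotics.isLittleO_of_tendsto (fun η hη => ?_) (hlim.congr' ?_)
  · have : η = 0 := by simpa using hη
    simp [this]
  · filter_upwards [hball] with η hη
    have h1 := h.risk_eq (hsub hη)
    have h2 := h.risk_eq h.param_mem
    simp only [shift_trueParam] at h2
    have i1 : Integrable (fun x => Z x (M.shift (M.trueParam + η) x) - Z x 0) M.predLaw :=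
      h1.1.sub h2.1
    have i2 : Integrable (fun x => 1 / 2 * Q η x) M.predLaw :=
      (h.integrable_quadratic _ _).const_mul _
    rw [integral_div, integral_sub i1 i2, integral_sub h1.1 h2.1, integral_const_mul, h1.2, h2.2]

end Regular

end Model

namespace Model

variable {q d : ℕ} {M : Model q d}

/-! ### The matrix `W₀` -/

/-- The second-moment matrix of the centered predictors, weighted by the curvature. -/
noncomputable def weightedCov (M : Model q d) : Matrix (Fin (q + 1)) (Fin (q + 1)) ℝ :=
  Matrix.of fun i j => ∫ x, M.curvature (index M.trueParam x) *
    (M.centered x i * M.centered x j) ∂M.predLaw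

theorem curvature_eq (u : ℝ) : M.curvature u =
    (M.linkDeriv M.trueParam u).ofLp ⬝ᵥ
      (M.F M.trueParam u *ᵥ (M.linkDeriv M.trueParam u).ofLp) := inner_hessMap _ _

namespace Regular

variable (h : M.Regular)

include h

theorem integrable_weightedCov (i j : Fin (q + 1)) :
    Integrable (fun x => M.curvature (index M.trueParam x) *
      (M.centered x i * M.centered x j)) M.predLaw := by
  have := h.integrable_quadratic (EuclideanSpace.single i 1) (EuclideanSpace.single j 1)
  simpa [EuclideanSpace.inner_single_right] using this

theorem integrable_centered_mul (i j : Fin (q + 1)) :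
    Integrable (fun x => M.centered x i * M.centered x j) M.predLaw := by
  have hc : ∀ k, ContinuousOn (fun x => M.centered x k) M.predictors := fun k =>
    (PiLp.proj 2 (fun _ : Fin (q + 1) => ℝ) k :
      E (q + 1) →L[ℝ] ℝ).continuous.comp_continuousOn h.continuousOn_centered
  exact h.integrable_of_continuousOn ((hc i).mul (hc j))

/-- The conditional covariance matrix can be replaced by the products that it averages. -/
theorem integral_curvature_mul_condCov (i j : Fin (q + 1)) :
    Integrable (fun z => M.curvature (index M.trueParam z.1) * M.condCov z i j) M.law ∧
    ∫ z, M.curvature (index M.trueParam z.1) * M.condCov z i j ∂M.law = M.weightedCov i j := by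
  have := h.prob
  set U : E (q + 1) × Sph d → ℝ := fun z => index M.trueParam z.1 with hU
  have hUm : Measurable U := measurable_index _
  obtain ⟨m, hm, hmeq⟩ := exists_measurable_eqOn (isClosed_indexSupp _) h.continuousOn_curvature
  have hae : (fun z => m (U z)) =ᵐ[M.law] fun z => M.curvature (U z) := by
    filter_upwards [ae_index_mem (M := M) M.trueParam] with z hz using hmeq hz
  have hsm : AEStronglyMeasurable[MeasurableSpace.comap U inferInstance]
      (fun z => M.curvature (U z)) M.law :=
    ⟨fun z => m (U z), hm.stronglyMeasurable.comp_measurable (comap_measurable U), hae.symm⟩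
  have hg : Integrable (fun z : E (q + 1) × Sph d => M.centered z.1 i * M.centered z.1 j)
      M.law := (h.integrable_centered_mul i j).comp_measurable measurable_fst
  have hfg : Integrable (fun z : E (q + 1) × Sph d => M.curvature (U z) *
      (M.centered z.1 i * M.centered z.1 j)) M.law :=
    (h.integrable_weightedCov i j).comp_measurable measurable_fst
  have key := condExp_mul_of_aestronglyMeasurable_left hsm hfg hg
  refine ⟨integrable_condExp.congr key, ?_⟩
  have h1 := integral_congr_ae key
  rw [integral_condExp hUm.comap_le] at h1
  refine h1.symm.trans ?_
  exact (integral_map measurable_fst.aemeasurable (h.integrable_weightedCov i j).1).symm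

/-- The curvature depends on the index alone, so under the expectation the conditional covariance
may be replaced by products of centred predictors. -/
theorem W0_eq : M.W0 = (jac M.trueParam)ᵀ * M.weightedCov * jac M.trueParam := by
  ext a b
  have h1 : ∀ z, ((M.linkDeriv M.trueParam (index M.trueParam z.1)).ofLp ⬝ᵥ
      (M.F M.trueParam (index M.trueParam z.1) *ᵥ
        (M.linkDeriv M.trueParam (index M.trueParam z.1)).ofLp)) *
      (((jac M.trueParam)ᵀ * M.condCov z * jac M.trueParam) a b) =
      ∑ j, ∑ i, jac M.trueParam i a * (M.curvature (index M.trueParam z.1) * M.condCov z i j) *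
        jac M.trueParam j b := fun z => by
    rw [← curvature_eq, Matrix.mul_apply, Finset.mul_sum]
    refine Finset.sum_congr rfl fun j _ => ?_
    rw [Matrix.mul_apply, Finset.sum_mul, Finset.mul_sum]
    refine Finset.sum_congr rfl fun i _ => ?_
    rw [Matrix.transpose_apply]
    ring
  have hi := fun i j => (((h.integral_curvature_mul_condCov i j).1.const_mul
    (jac M.trueParam i a)).mul_const (jac M.trueParam j b))
  simp only [W0, Matrix.of_apply, h1]
  rw [integral_finsetSum _ fun j _ => integrable_finsetSum _ fun i _ => hi i j, Matrix.mul_apply]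
  refine Finset.sum_congr rfl fun j _ => ?_
  rw [integral_finsetSum _ fun i _ => hi i j, Matrix.mul_apply, Finset.sum_mul]
  refine Finset.sum_congr rfl fun i _ => ?_
  rw [integral_mul_const, integral_const_mul, (h.integral_curvature_mul_condCov i j).2,
    Matrix.transpose_apply]

theorem dotProduct_weightedCov (v w : E (q + 1)) :
    v.ofLp ⬝ᵥ (M.weightedCov *ᵥ w.ofLp) = ∫ x, M.curvature (index M.trueParam x) *
      ((inner ℝ (M.centered x) v : ℝ) * inner ℝ (M.centered x) w) ∂M.predLaw := by
  have h1 : ∀ x, M.curvature (index M.trueParam x) *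
      ((inner ℝ (M.centered x) v : ℝ) * inner ℝ (M.centered x) w) =
      ∑ i, ∑ j, v i * (M.curvature (index M.trueParam x) *
        (M.centered x i * M.centered x j)) * w j := fun x => by
    simp only [PiLp.inner_apply, RCLike.inner_apply, conj_trivial]
    rw [Finset.sum_mul_sum, Finset.mul_sum]
    refine Finset.sum_congr rfl fun i _ => ?_
    rw [Finset.mul_sum]
    refine Finset.sum_congr rfl fun j _ => ?_
    ring
  have hi := fun i j => ((h.integrable_weightedCov i j).const_mul (v i)).mul_const (w j)
  simp only [h1]
  rw [integral_finsetSum _ fun i _ => integrable_finsetSum _ fun j _ => hi i j]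
  simp only [dotProduct, Matrix.mulVec, Finset.mul_sum]
  refine Finset.sum_congr rfl fun i _ => ?_
  rw [integral_finsetSum _ fun j _ => hi i j]
  refine Finset.sum_congr rfl fun j _ => ?_
  rw [integral_mul_const, integral_const_mul, weightedCov, Matrix.of_apply, mul_assoc]

/-- With `ξ = η` the right side is the integral in `isLittleO_risk`: `W₀` is the second derivative
of the risk at `θ₀` in the Taylor sense. -/
theorem inner_W0 (η ξ : E q) :
    (inner ℝ (matrixMap M.W0 η) ξ : ℝ) = ∫ x, M.curvature (index M.trueParam x) *
      ((inner ℝ (M.centered x) (matrixMap (jac M.trueParam) ξ) : ℝ) *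
        inner ℝ (M.centered x) (matrixMap (jac M.trueParam) η)) ∂M.predLaw := by
  rw [← h.dotProduct_weightedCov, h.W0_eq]
  have : (inner ℝ (matrixMap ((jac M.trueParam)ᵀ * M.weightedCov * jac M.trueParam) η) ξ : ℝ) =
      ξ.ofLp ⬝ᵥ (((jac M.trueParam)ᵀ * M.weightedCov * jac M.trueParam) *ᵥ η.ofLp) := by
    simp [matrixMap_apply, PiLp.inner_apply, dotProduct]
  rw [this, matrixMap_apply, matrixMap_apply, ← Matrix.mulVec_mulVec, ← Matrix.mulVec_mulVec,
    Matrix.dotProduct_mulVec, Matrix.vecMul_transpose]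

theorem inner_W0_comm (η ξ : E q) :
    (inner ℝ (matrixMap M.W0 η) ξ : ℝ) = inner ℝ η (matrixMap M.W0 ξ) := by
  rw [← real_inner_comm η (matrixMap M.W0 ξ), h.inner_W0, h.inner_W0]
  simp only [mul_comm (inner ℝ (M.centered _) (matrixMap (jac M.trueParam) ξ) : ℝ)]

theorem inner_W0_nonneg (η : E q) : 0 ≤ (inner ℝ (matrixMap M.W0 η) η : ℝ) := by
  rw [h.inner_W0]
  refine integral_nonneg_of_ae ?_
  filter_upwards [ae_predLaw_index_mem (M := M) M.trueParam] with x hx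
  exact mul_nonneg (h.curvature_nonneg hx) (mul_self_nonneg _)

/-- An invertible positive semidefinite symmetric matrix is positive definite; this is where the
invertibility of `W₀` becomes coercivity. -/
theorem inner_W0_pos (hW : IsUnit M.W0) {η : E q} (hη : η ≠ 0) :
    0 < (inner ℝ (matrixMap M.W0 η) η : ℝ) := by
  have hdot : ∀ v w : Fin q → ℝ, w ⬝ᵥ (M.W0 *ᵥ v) =
      (inner ℝ (matrixMap M.W0 (WithLp.toLp 2 v)) (WithLp.toLp 2 w : E q) : ℝ) := fun v w => by
    simp [matrixMap_apply, PiLp.inner_apply, dotProduct]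
  have hpsd : M.W0.PosSemidef := by
    rw [Matrix.posSemidef_iff_dotProduct_mulVec]
    refine ⟨?_, fun v => ?_⟩
    · ext a b
      have h1 := h.inner_W0_comm (EuclideanSpace.single a 1) (EuclideanSpace.single b 1)
      simpa [matrixMap_apply, EuclideanSpace.inner_single_right,
        EuclideanSpace.inner_single_left] using h1
    · rw [star_trivial, hdot]
      exact h.inner_W0_nonneg _
  have h2 := (hpsd.posDef_iff_isUnit.2 hW).dotProduct_mulVec_pos (x := η.ofLp) (by simpa using hη)
  rw [star_trivial, hdot] at h2
  exact h2

/-! ### The influence function -/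

/-- The closed form of the influence function. -/
theorem hasInfluenceAt (hW : IsUnit M.W0) {z : E (q + 1) × Sph d} (hz : z ∈ M.observations) :
    M.HasInfluenceAt z
      ((inner ℝ (gradient M.loss (M.resid M.trueParam (index M.trueParam z.1) z.2))
          (M.linkDeriv M.trueParam (index M.trueParam z.1)) : ℝ) •
        WithLp.toLp 2 ((M.W0⁻¹ * (jac M.trueParam)ᵀ) *ᵥ (M.centered z.1).ofLp)) := by
  obtain ⟨ρ, hρ, hsub, -⟩ := h.exists_lipschitz_shift
  set κ : ℝ := inner ℝ (gradient M.loss (M.resid M.trueParam (index M.trueParam z.1) z.2))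
    (M.linkDeriv M.trueParam (index M.trueParam z.1)) with hκ
  have hu := h.index_mem h.param_mem (show z.1 ∈ M.predictors from hz)
  obtain ⟨c, hc, hcoer⟩ := exists_coercive (V := E q)
    (Q := fun η => (inner ℝ (matrixMap M.W0 η) η : ℝ)) (by fun_prop)
    (fun s η => by simp only [map_smul, inner_smul_left, inner_smul_right, conj_trivial]; ring)
    (fun η hη => h.inner_W0_pos hW hη)
  have hexp : (fun η => M.risk M.law (M.trueParam + η) - M.risk M.law M.trueParam -
      1 / 2 * inner ℝ (matrixMap M.W0 η) η) =o[𝓝 0] fun η => ‖η‖ ^ 2 := by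
    simp only [h.inner_W0]
    exact h.isLittleO_risk
  -- The sign is negative because the link is subtracted in the residual.
  have hgrad : HasGradientAt (M.obsLoss z)
      (-(κ • (WithLp.toLp 2 ((jac M.trueParam)ᵀ *ᵥ (M.centered z.1).ofLp) : E q)))
      M.trueParam := by
    have hdiff : DifferentiableAt ℝ M.loss (M.resid M.trueParam (index M.trueParam z.1) z.2) := by
      obtain ⟨s, hs, hd, -⟩ := (h.a3.2.1 _ h.param_mem _ hu).1 z.2
      exact hd _ (mem_of_mem_nhds hs)
    have h1 : HasFDerivAt (fun θ => M.resid θ (index θ z.1) z.2) (-M.pathDeriv z.1)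
        M.trueParam := (h.hasFDerivAt_path hz).const_sub _
    have h2 := HasFDerivAt.comp M.trueParam hdiff.hasGradientAt.hasFDerivAt h1
    refine h2.congr_fderiv ?_
    ext η
    have h3 : (inner ℝ (M.centered z.1) (matrixMap (jac M.trueParam) η) : ℝ) =
        inner ℝ (WithLp.toLp 2 ((jac M.trueParam)ᵀ *ᵥ (M.centered z.1).ofLp) : E q) η := by
      have e1 : (inner ℝ (M.centered z.1) (matrixMap (jac M.trueParam) η) : ℝ) =
          (M.centered z.1).ofLp ⬝ᵥ (jac M.trueParam *ᵥ η.ofLp) := by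
        simp [matrixMap_apply, PiLp.inner_apply, dotProduct, mul_comm]
      rw [e1, Matrix.dotProduct_mulVec, ← Matrix.mulVec_transpose]
      simp [PiLp.inner_apply, dotProduct, mul_comm]
    simp only [ContinuousLinearMap.comp_apply, neg_apply, InnerProductSpace.toDual_apply_apply,
      inner_neg_right, h.pathDeriv_eq hz, inner_smul_right, h3, inner_neg_left, inner_smul_left,
      conj_trivial, ← hκ]
    ring
  -- The candidate solves `W₀ v = -∇s(θ₀)`; the double negation keeps the gradient in the form of
  -- `hgrad`.
  have hWv : matrixMap M.W0 (κ • (WithLp.toLp 2 ((M.W0⁻¹ * (jac M.trueParam)ᵀ) *ᵥ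
      (M.centered z.1).ofLp) : E q)) =
      - -(κ • (WithLp.toLp 2 ((jac M.trueParam)ᵀ *ᵥ (M.centered z.1).ofLp) : E q)) := by
    rw [neg_neg, map_smul, matrixMap_apply, Matrix.mulVec_mulVec, ← Matrix.mul_assoc,
      Matrix.mul_nonsing_inv _ ((Matrix.isUnit_iff_isUnit_det _).1 hW), Matrix.one_mul]
  filter_upwards [self_mem_nhdsWithin, nhdsWithin_le_nhds (eventually_lt_nhds hρ)] with r hr hrρ
  set B := Metric.closedBall M.trueParam r
  have hr0 : 0 < r := hr
  have hB : B ⊆ Param q := (Metric.closedBall_subset_closedBall hrρ.le).trans hsub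
  have hBc : IsCompact B := isCompact_closedBall _ _
  have hBn : B ∈ 𝓝 M.trueParam := Metric.closedBall_mem_nhds _ hr0
  have hRc := h.continuousOn_risk hB hBc
  have hsc := (h.continuousOn_obsLoss_param hz).mono hB
  have hε1 : ∀ᶠ ε in 𝓝[≥] (0 : ℝ), 0 ≤ ε ∧ ε ≤ 1 := by
    filter_upwards [self_mem_nhdsWithin, nhdsWithin_le_nhds (eventually_le_nhds one_pos)] with
      ε h0 h1 using ⟨h0, h1⟩
  constructor
  · filter_upwards [hε1] with ε hε
    have hcont : ContinuousOn (M.risk (M.contaminated z ε)) B :=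
      ((hRc.const_smul (1 - ε)).add (hsc.const_smul ε)).congr fun θ hθ =>
        h.risk_contaminated (hB hθ) hε.1 hε.2 z
    obtain ⟨θ, hθ, hmin⟩ := hBc.exists_isMinOn ⟨_, mem_of_mem_nhds hBn⟩ hcont
    exact ⟨θ, hθ, hmin⟩
  · intro T hT
    have hT0 : T 0 = M.trueParam := by
      -- The filter `𝓝[≥] 0` includes the point `0`, so the hypothesis constrains `T 0`.
      have h1 := hT.self_of_nhdsWithin (mem_Ici.2 le_rfl)
      by_contra hne
      have h2 := h.risk_lt (hB h1.1) hne
      have h3 : M.risk (M.contaminated z 0) (T 0) ≤ M.risk (M.contaminated z 0) M.trueParam :=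
        h1.2 (mem_of_mem_nhds hBn)
      rw [h.risk_contaminated (hB h1.1) le_rfl zero_le_one,
        h.risk_contaminated h.param_mem le_rfl zero_le_one] at h3
      linarith
    refine ⟨hT0, ?_⟩
    rw [hT0]
    refine tendsto_slope_perturbed_min hBc hRc hsc hBn
      (fun θ hθ hne => h.risk_lt (hB hθ) hne) h.inner_W0_comm hc hcoer hexp hgrad hWv ?_
    filter_upwards [nhdsWithin_mono 0 Ioi_subset_Ici_self hT,
      nhdsWithin_mono 0 Ioi_subset_Ici_self hε1] with ε h1 hε
    refine ⟨h1.1, fun θ hθ => ?_⟩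
    have h2 : M.risk (M.contaminated z ε) (T ε) ≤ M.risk (M.contaminated z ε) θ := h1.2 hθ
    rwa [h.risk_contaminated (hB h1.1) hε.1 hε.2, h.risk_contaminated (hB hθ) hε.1 hε.2] at h2

end Regular

/-- The influence function has at most one value. -/
theorem HasInfluenceAt.unique {z : E (q + 1) × Sph d} {v w : E q} (hv : M.HasInfluenceAt z v)
    (hw : M.HasInfluenceAt z w) : v = w := by
  classical
  -- Some radius serves both values; one selection of minimizers on that ball then has both as the
  -- limit of its difference quotients.
  obtain ⟨r, ⟨hex, hv'⟩, -, hw'⟩ := (hv.and hw).exists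
  let T : ℝ → E q := fun ε =>
    if hε : ∃ θ, M.IsLocalMEst r (M.contaminated z ε) θ then hε.choose else 0
  have hT : ∀ᶠ ε in 𝓝[≥] (0 : ℝ), M.IsLocalMEst r (M.contaminated z ε) (T ε) := by
    filter_upwards [hex] with ε hε
    simp only [T, dif_pos hε]
    exact hε.choose_spec
  exact tendsto_nhds_unique (hv' T hT).2 (hw' T hT).2

theorem HasInfluenceAt.influence_eq {z : E (q + 1) × Sph d} {v : E q}
    (hv : M.HasInfluenceAt z v) : M.influence z = v := by
  have hex : ∃ v, M.HasInfluenceAt z v := ⟨v, hv⟩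
  rw [influence, dif_pos hex]
  exact hex.choose_spec.unique hv

/-- The score bound is finite. -/
theorem Regular.scoreBound_lt_top (h : M.Regular) : M.scoreBound < ⊤ := by
  obtain ⟨A, hA⟩ := (h.isCompact_residuals h.param_mem).exists_bound_of_continuousOn
    (h.continuousOn_gradient h.param_mem)
  obtain ⟨B, hB⟩ := (h.isCompact_indexSupp M.trueParam).exists_bound_of_continuousOn
    h.continuousOn_linkDeriv
  obtain ⟨C, hC⟩ := h.a1.1.exists_bound_of_continuousOn h.continuousOn_centered
  have hle : M.scoreBound ≤ ENNReal.ofReal A * ENNReal.ofReal B * ENNReal.ofReal C := by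
    refine iSup₂_le fun z hz => ?_
    have hu := h.index_mem h.param_mem (show z.1 ∈ M.predictors from hz)
    have e : ∀ {G : Type} [NormedAddCommGroup G] {v : G} {D : ℝ}, ‖v‖ ≤ D →
        ‖v‖ₑ ≤ ENNReal.ofReal D := fun hv => by
      rw [← ofReal_norm]; exact ENNReal.ofReal_le_ofReal hv
    exact mul_le_mul' (mul_le_mul' (e (hA _ (range_resid_subset hu (mem_range_self _))))
      (e (hB _ hu))) (e (hC _ hz))
  refine hle.trans_lt (ENNReal.mul_lt_top (ENNReal.mul_lt_top ?_ ?_) ?_) <;>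
    exact ENNReal.ofReal_lt_top

end Model

end SphericalSIM

theorem corollary2 {q d : ℕ} (hd : 2 < d) (M : SphericalSIM.Model q d)
    (hlaw : MeasureTheory.IsProbabilityMeasure M.law)
    (hdens : M.IsCondDens) (hlink : M.IsLink) (hsmooth : M.SmoothLink)
    (hparam : M.IsTrueParam) (hmean : M.IsCondMean)
    (κ : ℝ) (hκ : 0 < κ) (hclass : M.InConcentrationClass κ)
    (hA1 : M.A1) (hA2 : M.A2) (hA3 : M.A3) (hA4 : M.A4) (hA5 : M.A5)
    (hW : IsUnit M.W0) :
    (∀ z ∈ M.observations, M.HasInfluenceAt z (M.influence z) ∧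
      M.influence z =
        (inner ℝ
          (gradient M.loss
            (M.resid M.trueParam (SphericalSIM.index M.trueParam z.1) z.2))
          (M.linkDeriv M.trueParam (SphericalSIM.index M.trueParam z.1)) : ℝ) •
        WithLp.toLp 2
          ((M.W0⁻¹ * (SphericalSIM.jac M.trueParam)ᵀ) *ᵥ (M.centered z.1).ofLp)) ∧
    M.grossErrorSensitivity ≤
      ENNReal.ofReal (SphericalSIM.specNorm (M.W0⁻¹ * (SphericalSIM.jac M.trueParam)ᵀ)) *
        M.scoreBound ∧
    ENNReal.ofReal (SphericalSIM.specNorm (M.W0⁻¹ * (SphericalSIM.jac M.trueParam)ᵀ)) *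
        M.scoreBound < ⊤ := by
  have h : M.Regular := ⟨hlaw, hdens, hlink, hsmooth, hparam, hmean, ⟨κ, hclass⟩, hA1, hA2, hA3, hA4⟩
  have hIF := fun z (hz : z ∈ M.observations) => h.hasInfluenceAt hW hz
  refine ⟨fun z hz => ?_, iSup₂_le fun z hz => ?_,
    ENNReal.mul_lt_top ENNReal.ofReal_lt_top h.scoreBound_lt_top⟩
  · have heq := (hIF z hz).influence_eq
    exact ⟨heq ▸ hIF z hz, heq⟩
  · rw [(hIF z hz).influence_eq, enorm_smul]
    set r := gradient M.loss (M.resid M.trueParam (SphericalSIM.index M.trueParam z.1) z.2)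
    set m := M.linkDeriv M.trueParam (SphericalSIM.index M.trueParam z.1)
    set A := M.W0⁻¹ * (SphericalSIM.jac M.trueParam)ᵀ
    have h1 : ‖(inner ℝ r m : ℝ)‖ₑ ≤ ‖r‖ₑ * ‖m‖ₑ := by
      simp only [← ofReal_norm]
      rw [← ENNReal.ofReal_mul (norm_nonneg _)]
      exact ENNReal.ofReal_le_ofReal (norm_inner_le_norm r m)
    have h2 : ‖(WithLp.toLp 2 (A *ᵥ (M.centered z.1).ofLp) : SphericalSIM.E q)‖ₑ ≤
        ENNReal.ofReal (SphericalSIM.specNorm A) * ‖M.centered z.1‖ₑ := by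
      simp only [← ofReal_norm]
      rw [← ENNReal.ofReal_mul (show 0 ≤ SphericalSIM.specNorm A from norm_nonneg _)]
      exact ENNReal.ofReal_le_ofReal ((SphericalSIM.matrixMap A).le_opNorm (M.centered z.1))
    have h3 : ‖r‖ₑ * ‖m‖ₑ * ‖M.centered z.1‖ₑ ≤ M.scoreBound :=
      le_iSup₂ (f := fun z (_ : z ∈ M.observations) =>
        ‖gradient M.loss (M.resid M.trueParam (SphericalSIM.index M.trueParam z.1) z.2)‖ₑ *
          ‖M.linkDeriv M.trueParam (SphericalSIM.index M.trueParam z.1)‖ₑ * ‖M.centered z.1‖ₑ) z hz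
    calc _ ≤ (‖r‖ₑ * ‖m‖ₑ) * (ENNReal.ofReal (SphericalSIM.specNorm A) * ‖M.centered z.1‖ₑ) :=
          mul_le_mul' h1 h2
      _ = ENNReal.ofReal (SphericalSIM.specNorm A) * (‖r‖ₑ * ‖m‖ₑ * ‖M.centered z.1‖ₑ) := by ring
      _ ≤ _ := by gcongr
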